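/- Call a system of vectors $\{u_n\}$ in a complex Hilbert space $H$ a (QF)-system if (i) for every real $q>2$ there is a constant $C(q)$ such that for every $f\in H$ and $\epsilon>0$ there is a finite linear combination $Q=\sum c_nu_n$ with $\|f-Q\|<\epsilon$ and $\left(\sum|c_n|^q\right)^{1/q}\le C(q)\|f\|$; and (ii) there is a constant $C'$ such that $\left(\sum_n|\langle f,u_n\rangle|^2\right)^{1/2}\le C'\|f\|$ for all $f\in H$. Call a sequence $\{\lambda_n\}$ of real numbers uniformly discrete if $\inf_{m\ne n}|\lambda_m-\lambda_n|>0$. **Proposition 1.** (1) There exist a uniformly discrete sequence $\{\lambda_n\}$ of real numbers and a function $g\in L^2(\mathbb{R})$ (complex-valued) such that $\{g(t-\lambda_n)\}$ is a (QF)-system in $L^2(\mathbb{R})$ and $g$ is infinitely differentiable; $g$ can even be chosen to be the restriction to $\mathbb{R}$ of an entire function. (2) For every sequence of positive numbers $\epsilon_n\to 0$, the sequence $\{\lambda_n\}$ and the function $g$ in (1), with $g$ the restriction to $\mathbb{R}$ of an entire function (in particular infinitely differentiable), can be chosen so that in addition $\lambda_n>0$ and $\lambda_{n+1}/\lambda_n>1+\epsilon_n$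 for all $n$. -/

import Mathlib

open MeasureTheory Filter Topology
open scoped ContDiff

/-- A sequence of real numbers is uniformly discrete if distinct terms are separated by a
fixed positive distance. -/
def UniformlyDiscrete (lam : ℕ → ℝ) : Prop :=
  ∃ δ : ℝ, 0 < δ ∧ ∀ m n : ℕ, m ≠ n → δ ≤ |lam m - lam n|

/-- A system of vectors `u n` in a complex Hilbert space is a (QF)-system if it is complete with
an `ℓ_q` estimate of the coefficients for every `q > 2` (finite linear combinations, with a
constant depending on `q` only), and it satisfies the Bessel inequality. -/
structure IsQFSystem {H : Type*} [NormedAddCommGroup H] [InnerProductSpace ℂ H]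
    {ι : Type*} (u : ι → H) : Prop where
  approx : ∀ q : ℝ, 2 < q → ∃ C : ℝ, ∀ (f : H) (η : ℝ), 0 < η → ∃ c : ι →₀ ℂ,
    ‖f - ∑ n ∈ c.support, c n • u n‖ < η ∧
    (∑ n ∈ c.support, ‖c n‖ ^ q) ^ (1 / q) ≤ C * ‖f‖
  bessel : ∃ C' : ℝ, ∀ f : H,
    Summable (fun n => ‖inner ℂ f (u n)‖ ^ 2) ∧
    Real.sqrt (∑' n, ‖inner ℂ f (u n)‖ ^ 2) ≤ C' * ‖f‖

/-- The translate `t ↦ g (t - a)` of a square integrable function `g`, as an element of the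
Hilbert space `L²(ℝ)`. -/
noncomputable def translateLp (g : ℝ → ℂ) (hg : MemLp g 2 volume) (a : ℝ) :
    Lp ℂ 2 (volume : Measure ℝ) :=
  MemLp.toLp (fun t : ℝ => g (t - a))
    (hg.comp_measurePreserving (measurePreserving_sub_right volume a))

/-!
Taking `g` to be the Fourier transform of a weight `w`, the translates of `g` become the
exponentials `exp (2 π i λ_n x)` in `L²(w²)`, and it suffices to choose `λ_n` and `w`.

A Riesz product `∏ (1 + r cos (2 π L_j x))` with many factors of small amplitude is small in
measure, while all its coefficients but the constant one are `ℓ^q`-small, `q > 2`. Its negative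
frequencies can be moved to the right at the cost of a set of small measure, by multiplying them
with a dilated polynomial in `exp (2 π i x)` without constant term which is close to `1` in
measure. This gives polynomials `Q` without constant term which are close to `1` in measure and
have `ℓ^q`-small coefficients. Then `exp (2 π i k x) Q(R x)` is close to `exp (2 π i k x)` in
measure on a long interval, and its spectrum is a piece of an arithmetic progression with a step
`R` as large as we like, so that such pieces for a sequence of rational numbers `k` can be put
together into a single sequence `λ_n` of any prescribed growth `1 + ε_n` with `ε_n → 0`.

A weight which decays where the approximation is bad turns convergence in measure into convergence
in `L²(w²)`. Every rational `k` occurs infinitely often, so an arbitrary combination of the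
exponentials `exp (2 π i k x)`, which span a dense subspace, can be approximated with coefficients
whose `ℓ^q` norm is arbitrarily small. Keeping the weight below a Gaussian gives the Bessel
inequality, because Gaussian Gram matrices decay away from the diagonal, and makes `g` entire.
-/

open scoped FourierTransform LaurentPolynomial

section CoefficientSums

/-- The sum `∑ |c_n| ^ p` over a finitely supported family of coefficients, i.e. the `p`-th power of
its `ℓ^p` norm. -/
noncomputable def powSum {ι : Type*} (p : ℝ) (c : ι →₀ ℂ) : ℝ := c.sum fun _ z => ‖z‖ ^ p

variable {ι κ : Type*} {p : ℝ}

lemma powSum_nonneg (p : ℝ) (c : ι →₀ ℂ) : 0 ≤ powSum p c :=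
  Finsupp.sum_nonneg fun _ _ => by positivity

lemma powSum_single (hp : p ≠ 0) (i : ι) (z : ℂ) : powSum p (Finsupp.single i z) = ‖z‖ ^ p :=
  Finsupp.sum_single_index (by simp [hp])

lemma powSum_neg (c : ι →₀ ℂ) : powSum p (-c) = powSum p c := by
  simp [powSum, Finsupp.sum]

lemma powSum_add_of_disjoint {c d : ι →₀ ℂ} (h : Disjoint c.support d.support) :
    powSum p (c + d) = powSum p c + powSum p d := by
  classical
  exact Finsupp.sum_add_index_of_disjoint h _

lemma powSum_smul (hp : p ≠ 0) (a : ℂ) (c : ι →₀ ℂ) :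
    powSum p (a • c) = ‖a‖ ^ p * powSum p c := by
  rw [powSum, Finsupp.sum_smul_index fun _ => by simp [hp], powSum, Finsupp.mul_sum]
  simp only [norm_mul, Real.mul_rpow (norm_nonneg _) (norm_nonneg _)]

lemma powSum_embDomain (e : ι ↪ κ) (c : ι →₀ ℂ) : powSum p (c.embDomain e) = powSum p c :=
  Finsupp.sum_embDomain

lemma powSum_le_of_exponent_le {q : ℝ} (hp : 0 < p) (hpq : p ≤ q) {c : ι →₀ ℂ}
    (hc : powSum p c ≤ 1) : powSum q c ≤ powSum p c := by
  refine Finset.sum_le_sum fun i hi => ?_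
  have hci : ‖c i‖ ^ p ≤ 1 := (Finset.single_le_sum (f := fun i => ‖c i‖ ^ p)
    (fun _ _ => by positivity) hi).trans hc
  refine Real.rpow_le_rpow_of_exponent_ge' (norm_nonneg _) ?_ hp.le hpq
  exact le_of_not_gt fun h => (Real.one_lt_rpow h hp).not_ge hci

lemma sum_finsetSum_of_pairwiseDisjoint {γ : Type*} [AddCommMonoid γ] {s : Finset κ}
    {b : κ → ι →₀ ℂ} (hb : (s : Set κ).PairwiseDisjoint fun u => (b u).support)
    (G : ι → ℂ → γ) : (∑ u ∈ s, b u).sum G = ∑ u ∈ s, (b u).sum G := by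
  classical
  induction s using Finset.induction_on with
  | empty => simp
  | insert u s hu ih =>
    rw [Finset.coe_insert, Set.pairwiseDisjoint_insert_of_notMem (by simpa using hu)] at hb
    have hdisj : Disjoint (b u).support (∑ v ∈ s, b v).support :=
      ((Finset.disjoint_biUnion_right _ _ _).2 hb.2).mono_right Finsupp.support_finsetSum
    rw [Finset.sum_insert hu, Finset.sum_insert hu, Finsupp.sum_add_index_of_disjoint hdisj,
      ih hb.1]

lemma sum_finsetSum_single {γ : Type*} [AddCommMonoid γ] {s : Finset κ} {ν : κ → ι}
    (hν : Set.InjOn ν s) (a : κ → ℂ) {G : ι → ℂ → γ} (hG : ∀ i, G i 0 = 0) :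
    (∑ u ∈ s, Finsupp.single (ν u) (a u)).sum G = ∑ u ∈ s, G (ν u) (a u) := by
  rw [sum_finsetSum_of_pairwiseDisjoint fun u hu v hv huv => ?_]
  · exact Finset.sum_congr rfl fun u _ => Finsupp.sum_single_index (hG _)
  · exact (Finset.disjoint_singleton.2 fun h => huv (hν hu hv h)).mono
      Finsupp.support_single_subset Finsupp.support_single_subset

end CoefficientSums

section TrigonometricPolynomials

/-- Evaluation at `x` of the trigonometric polynomial `∑ P_n exp (2 π i n x)`, which is encoded by
the Laurent polynomial `P` with the same coefficients. -/
noncomputable def trigEval (x : ℝ) : ℂ[T;T⁻¹] →+* ℂ :=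
  LaurentPolynomial.eval₂ (RingHom.id ℂ) (Circle.toUnits (𝐞 x))

lemma fourierChar_intCast_mul (n : ℤ) (x : ℝ) : 𝐞 (n * x) = 𝐞 x ^ n := by
  rw [← zsmul_eq_mul, AddChar.map_zsmul_eq_zpow]

lemma fourierChar_add_one (x : ℝ) : 𝐞 (x + 1) = 𝐞 x := by
  ext; simp [AddChar.map_add_eq_mul, Real.fourierChar_apply]

@[fun_prop]
lemma continuous_coe_fourierChar : Continuous fun x : ℝ => (𝐞 x : ℂ) :=
  continuous_subtype_val.comp Real.continuous_fourierChar

lemma trigEval_single (x : ℝ) (n : ℤ) (z : ℂ) :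
    trigEval x (.single n z) = z * 𝐞 (n * x) := by
  rw [LaurentPolynomial.single_eq_C_mul_T, trigEval, LaurentPolynomial.eval₂_C_mul_T,
    fourierChar_intCast_mul, ← map_zpow]
  rfl

lemma trigEval_eq_sum (x : ℝ) (P : ℂ[T;T⁻¹]) :
    trigEval x P = P.coeff.sum fun n z => z * 𝐞 (n * x) := by
  conv_lhs => rw [← AddMonoidAlgebra.sum_coeff_single P, map_finsuppSum]
  simp only [trigEval_single]

lemma trigEval_toLaurent (x : ℝ) (p : Polynomial ℂ) :
    trigEval x p.toLaurent = p.eval (𝐞 x : ℂ) := by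
  rw [trigEval, LaurentPolynomial.eval₂_toLaurent]; rfl

@[fun_prop]
lemma continuous_trigEval (P : ℂ[T;T⁻¹]) : Continuous fun x => trigEval x P := by
  simp only [trigEval_eq_sum, Finsupp.sum]; fun_prop

lemma integral_fourierChar_intCast_mul (n : ℤ) :
    ∫ x in (0 : ℝ)..1, (𝐞 (n * x) : ℂ) = if n = 0 then 1 else 0 := by
  split_ifs with hn
  · simp [hn]
  have h : (2 * Real.pi * n * Complex.I : ℂ) ≠ 0 := by simp [hn, Real.pi_ne_zero]
  have hexp (x : ℝ) : (𝐞 (n * x) : ℂ) = Complex.exp (2 * Real.pi * n * Complex.I * x) := by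
    rw [Real.fourierChar_apply]; congr 1; push_cast; ring
  have hone : 𝐞 (1 : ℝ) = 1 := by simpa using fourierChar_add_one 0
  simp_rw [hexp, integral_exp_mul_complex h, ← hexp]
  rw [fourierChar_intCast_mul, fourierChar_intCast_mul, hone]
  simp

/-- The dilation `P(T) ↦ P(T ^ L)`, i.e. `x ↦ L x` for the trigonometric polynomial, which serves to
spread out the spectrum. -/
noncomputable def dilate (L : ℤ) : ℂ[T;T⁻¹] →+* ℂ[T;T⁻¹] :=
  AddMonoidAlgebra.mapDomainRingHom ℂ (AddMonoidHom.mulLeft L)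

lemma dilate_single (L n : ℤ) (z : ℂ) :
    dilate L (.single n z) = .single (L * n) z :=
  AddMonoidAlgebra.mapDomain_single

lemma dilate_eq_sum (L : ℤ) (P : ℂ[T;T⁻¹]) :
    dilate L P = P.coeff.sum fun n z => .single (L * n) z := by
  conv_lhs => rw [← AddMonoidAlgebra.sum_coeff_single P, map_finsuppSum]
  simp only [dilate_single]

lemma trigEval_dilate (x : ℝ) (L : ℤ) (P : ℂ[T;T⁻¹]) :
    trigEval x (dilate L P) = trigEval (L * x) P := by
  rw [dilate_eq_sum, map_finsuppSum, trigEval_eq_sum]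
  simp only [trigEval_single]
  push_cast
  simp only [mul_comm (L : ℝ), mul_assoc]

lemma integral_norm_sq_trigEval (P : ℂ[T;T⁻¹]) :
    ∫ x in (0 : ℝ)..1, ‖trigEval x P‖ ^ 2 = powSum 2 P.coeff := by
  have expand : ∀ x : ℝ, ((‖trigEval x P‖ ^ 2 : ℝ) : ℂ) = ∑ n ∈ P.coeff.support,
      ∑ m ∈ P.coeff.support, P.coeff n * starRingEnd ℂ (P.coeff m) * 𝐞 ((n - m : ℤ) * x) :=
    fun x => by
      rw [trigEval_eq_sum, Finsupp.sum, ← Complex.normSq_eq_norm_sq,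
        Complex.normSq_eq_conj_mul_self, mul_comm, map_sum, Finset.sum_mul_sum]
      refine Finset.sum_congr rfl fun n _ => Finset.sum_congr rfl fun m _ => ?_
      rw [map_mul (starRingEnd ℂ), ← Circle.coe_inv_eq_conj, ← AddChar.map_neg_eq_inv,
        mul_mul_mul_comm, ← Circle.coe_mul, ← AddChar.map_add_eq_mul, Int.cast_sub, sub_mul,
        sub_eq_add_neg]
  have h : ((∫ x in (0 : ℝ)..1, ‖trigEval x P‖ ^ 2 : ℝ) : ℂ) = (powSum 2 P.coeff : ℝ) := by
    rw [← intervalIntegral.integral_ofReal]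
    simp_rw [expand, powSum, Finsupp.sum, Complex.ofReal_sum]
    rw [intervalIntegral.integral_finsetSum fun n _ =>
      Continuous.intervalIntegrable (by fun_prop) _ _]
    refine Finset.sum_congr rfl fun n hn => ?_
    rw [intervalIntegral.integral_finsetSum fun m _ =>
      Continuous.intervalIntegrable (by fun_prop) _ _]
    simp_rw [intervalIntegral.integral_const_mul, integral_fourierChar_intCast_mul, mul_ite,
      mul_zero, sub_eq_zero]
    rw [Finset.sum_ite_eq, if_pos hn]
    simp [Complex.mul_conj, Complex.normSq_eq_norm_sq]
  exact_mod_cast h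

variable {d : ℕ} {L : ℤ} {P : ℂ[T;T⁻¹]}

lemma exists_abs_le_of_mem_support (P : ℂ[T;T⁻¹]) : ∃ d : ℕ, ∀ n ∈ P.coeff.support, |n| ≤ d :=
  ⟨P.coeff.support.sup Int.natAbs, fun n hn => by
    rw [Int.abs_eq_natAbs]; exact_mod_cast Finset.le_sup (f := Int.natAbs) hn⟩

lemma eq_and_eq_of_add_mul_eq {n n' m m' : ℤ} (hL : 2 * d < L) (hn : |n| ≤ d) (hn' : |n'| ≤ d)
    (h : n + L * m = n' + L * m') : n = n' ∧ m = m' := by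
  rw [abs_le] at hn hn'
  have hm : m = m' := by
    rcases lt_trichotomy m m' with hlt | heq | hlt
    · nlinarith
    · exact heq
    · nlinarith
  exact ⟨by subst hm; linarith, hm⟩

lemma coeff_mul_dilate (P Q : ℂ[T;T⁻¹]) (L : ℤ) :
    (P * dilate L Q).coeff = ∑ u ∈ P.coeff.support ×ˢ Q.coeff.support,
      Finsupp.single (u.1 + L * u.2) (P.coeff u.1 * Q.coeff u.2) := by
  conv_lhs => rw [← AddMonoidAlgebra.sum_coeff_single P, dilate_eq_sum, Finsupp.sum, Finsupp.sum,
    Finset.sum_mul_sum, ← Finset.sum_product']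
  simp only [AddMonoidAlgebra.single_mul_single, AddMonoidAlgebra.coeff_sum,
    AddMonoidAlgebra.coeff_single]

lemma exists_add_mul_eq_of_mem_support_mul_dilate {Q : ℂ[T;T⁻¹]} {k : ℤ}
    (hk : k ∈ (P * dilate L Q).coeff.support) :
    ∃ n ∈ P.coeff.support, ∃ m ∈ Q.coeff.support, n + L * m = k := by
  classical
  rw [coeff_mul_dilate] at hk
  obtain ⟨u, hu, hku⟩ := Finset.mem_biUnion.1 (Finsupp.support_finsetSum hk)
  rw [Finset.mem_product] at hu
  exact ⟨u.1, hu.1, u.2, hu.2, (Finset.mem_singleton.1 (Finsupp.support_single_subset hku)).symm⟩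

variable (hd : ∀ n ∈ P.coeff.support, |n| ≤ d) (hL : 2 * d < L) (Q : ℂ[T;T⁻¹])
include hd hL

lemma coeff_mul_dilate_zero : (P * dilate L Q).coeff 0 = P.coeff 0 * Q.coeff 0 := by
  rw [coeff_mul_dilate, Finsupp.finsetSum_apply, Finset.sum_eq_single (0, 0)]
  · simp
  · rintro ⟨n, m⟩ hu hne
    refine Finsupp.single_eq_of_ne fun h => hne ?_
    obtain ⟨rfl, rfl⟩ := eq_and_eq_of_add_mul_eq (n := 0) (m := 0) hL (by simp)
      (hd n (Finset.mem_product.1 hu).1) (by simpa using h)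
    rfl
  · intro h
    rw [Finset.mem_product, not_and_or, Finsupp.notMem_support_iff, Finsupp.notMem_support_iff] at h
    rcases h with h | h <;> simp [h]

lemma powSum_mul_dilate {p : ℝ} (hp : p ≠ 0) :
    powSum p (P * dilate L Q).coeff = powSum p P.coeff * powSum p Q.coeff := by
  have hinj : Set.InjOn (fun u : ℤ × ℤ => u.1 + L * u.2)
      (P.coeff.support ×ˢ Q.coeff.support : Finset (ℤ × ℤ)) := by
    rintro ⟨n, m⟩ hu ⟨n', m'⟩ hu' h
    simp only [Finset.coe_product, Set.mem_prod, Finset.mem_coe] at hu hu'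
    obtain ⟨rfl, rfl⟩ := eq_and_eq_of_add_mul_eq hL (hd _ hu.1) (hd _ hu'.1) h
    rfl
  rw [powSum, coeff_mul_dilate, sum_finsetSum_single hinj _ (by simp [hp]), Finset.sum_product]
  simp_rw [norm_mul, Real.mul_rpow (norm_nonneg _) (norm_nonneg _)]
  exact (Finset.sum_mul_sum ..).symm

lemma lt_of_mem_support_mul_dilate {Q : ℂ[T;T⁻¹]} (hQ : ∀ m ∈ Q.coeff.support, 0 < m) {n : ℤ}
    (hn : n ∈ (P * dilate L Q).coeff.support) : d < n := by
  obtain ⟨k, hk, m, hm, rfl⟩ := exists_add_mul_eq_of_mem_support_mul_dilate hn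
  nlinarith [abs_le.1 (hd k hk), hQ m hm]

end TrigonometricPolynomials

section UnitInterval

lemma min_one_add_le {a b : ℝ} (ha : 0 ≤ a) (hb : 0 ≤ b) :
    min 1 (a + b) ≤ min 1 a + min 1 b := by
  rcases min_cases 1 (a + b) with h | h <;> rcases min_cases 1 a with h' | h' <;>
    rcases min_cases 1 b with h'' | h'' <;> linarith

lemma integral_comp_intCast_mul_of_periodic {f : ℝ → ℝ} (hf : Continuous f)
    (hper : Function.Periodic f 1) {R : ℤ} (hR : R ≠ 0) (a b : ℤ) :
    ∫ x in (a : ℝ)..b, f (R * x) = (b - a) * ∫ x in (0 : ℝ)..1, f x := by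
  have hR' : (R : ℝ) ≠ 0 := by exact_mod_cast hR
  have h := hper.intervalIntegral_add_zsmul_eq (R * (b - a)) (R * a)
    fun _ _ => hf.intervalIntegrable _ _
  have hend : (R * a : ℝ) + (R * (b - a)) • (1 : ℝ) = R * b := by rw [zsmul_one]; push_cast; ring
  rw [hend, hper.intervalIntegral_add_eq (R * a) 0, zero_add, zsmul_eq_mul] at h
  rw [intervalIntegral.integral_comp_mul_left _ hR', h, smul_eq_mul]
  push_cast
  field_simp

lemma tendsto_integral_min_one {g : ℕ → ℝ → ℝ} {g' : ℝ → ℝ} (hg : ∀ n, Measurable (g n))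
    (hg0 : ∀ n x, 0 ≤ g n x)
    (hlim : ∀ x ∈ Set.Ioo (0 : ℝ) 1, Tendsto (fun n => g n x) atTop (𝓝 (g' x))) :
    Tendsto (fun n => ∫ x in (0 : ℝ)..1, min 1 (g n x)) atTop
      (𝓝 (∫ x in (0 : ℝ)..1, min 1 (g' x))) := by
  refine intervalIntegral.tendsto_integral_filter_of_dominated_convergence (fun _ => 1)
    (Eventually.of_forall fun n => (measurable_const.min (hg n)).aestronglyMeasurable)
    (Eventually.of_forall fun n => Eventually.of_forall fun x _ => ?_) (by simp) ?_
  · rw [Real.norm_of_nonneg (le_min zero_le_one (hg0 n x))]; exact min_le_left _ _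
  · have hne : ∀ᵐ x : ℝ, x ≠ 1 := by simp [ae_iff]
    filter_upwards [hne] with x hx hx'
    rw [Set.uIoc_of_le zero_le_one] at hx'
    exact tendsto_const_nhds.min (hlim x ⟨hx'.1, lt_of_le_of_ne hx'.2 hx⟩)

lemma tendsto_integral_mul_cos {f : ℝ → ℝ} (hf : Continuous f) :
    Tendsto (fun M : ℕ => ∫ x in (0 : ℝ)..1, f x * Real.cos (2 * Real.pi * (M * x))) atTop
      (𝓝 0) := by
  have riemann_lebesgue := Real.tendsto_integral_exp_smul_cocompact
    ((Set.Ioc (0 : ℝ) 1).indicator fun x => ((f x : ℝ) : ℂ))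
  have hcast : Tendsto (fun M : ℕ => (M : ℝ)) atTop (cocompact ℝ) :=
    tendsto_natCast_atTop_atTop.mono_right atTop_le_cocompact
  refine ((Complex.continuous_re.tendsto _).comp (riemann_lebesgue.comp hcast)).congr fun M => ?_
  have hint : IntegrableOn (fun x => 𝐞 (-(x * M)) • (f x : ℂ)) (Set.Ioc (0 : ℝ) 1) := by
    simp only [Circle.smul_def]
    exact (Continuous.integrableOn_Icc (by fun_prop)).mono_set Set.Ioc_subset_Icc_self
  simp only [Function.comp_apply, ← Set.indicator_smul_apply (Set.Ioc (0 : ℝ) 1)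
    (fun x : ℝ => 𝐞 (-(x * M))) fun x => (f x : ℂ)]
  rw [integral_indicator measurableSet_Ioc, intervalIntegral.integral_of_le zero_le_one,
    ← RCLike.re_to_complex, ← integral_re hint]
  refine integral_congr_ae (Eventually.of_forall fun x => ?_)
  simp only [Circle.smul_def, Real.fourierChar_apply, smul_eq_mul, RCLike.re_to_complex,
    Complex.re_mul_ofReal, Complex.exp_ofReal_mul_I_re]
  rw [← Real.cos_neg, mul_comm]
  ring_nf

end UnitInterval

section PolynomialsNearOne

open Polynomial in
/-- Cesàro means of the partial sums of `∑ z ^ m`, `m ≥ 1`. They are polynomials without constant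
term which converge to `z / (1 - z)` on the unit circle, away from `1`. -/
noncomputable def cesaroGeom (n : ℕ) : ℂ[X] :=
  C (1 / (n : ℂ)) * ∑ i ∈ Finset.range n, ∑ m ∈ Finset.range i, X ^ (m + 1)

lemma eval_zero_cesaroGeom (n : ℕ) : (cesaroGeom n).eval 0 = 0 := by
  simp [cesaroGeom, Polynomial.eval_finsetSum]

lemma eval_cesaroGeom {n : ℕ} (hn : n ≠ 0) {z : ℂ} (hz : z ≠ 1) :
    (cesaroGeom n).eval z = z / (1 - z) * (1 - 1 / (n : ℂ) * ((z ^ n - 1) / (z - 1))) := by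
  have hn' : (n : ℂ) ≠ 0 := by exact_mod_cast hn
  have hz' : 1 - z ≠ 0 := sub_ne_zero.2 hz.symm
  have inner_sum : ∀ i, ∑ m ∈ Finset.range i, z ^ (m + 1) = z / (1 - z) * (1 - z ^ i) := fun i => by
    simp_rw [pow_succ']
    rw [← Finset.mul_sum, div_mul_eq_mul_div, eq_div_iff hz', mul_assoc, mul_comm _ (1 - z),
      mul_neg_geom_sum]
  simp only [cesaroGeom, Polynomial.eval_mul, Polynomial.eval_C, Polynomial.eval_finsetSum,
    Polynomial.eval_pow, Polynomial.eval_X, inner_sum]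
  rw [← Finset.mul_sum, Finset.sum_sub_distrib, geom_sum_eq hz, Finset.sum_const,
    Finset.card_range, nsmul_one]
  field_simp

lemma tendsto_eval_cesaroGeom {z : ℂ} (hz : ‖z‖ = 1) (hz1 : z ≠ 1) :
    Tendsto (fun n => (cesaroGeom n).eval z) atTop (𝓝 (z / (1 - z))) := by
  have hmean : Tendsto (fun n : ℕ => 1 / (n : ℂ) * ((z ^ n - 1) / (z - 1))) atTop (𝓝 0) := by
    refine squeeze_zero_norm (a := fun n : ℕ => 1 / (n : ℝ) * (2 / ‖z - 1‖)) (fun n => ?_)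
      (by simpa using (tendsto_one_div_atTop_nhds_zero_nat (𝕜 := ℝ)).mul_const (2 / ‖z - 1‖))
    rw [norm_mul, norm_div, norm_div, norm_one, Complex.norm_natCast]
    gcongr
    calc ‖z ^ n - 1‖ ≤ ‖z ^ n‖ + ‖(1 : ℂ)‖ := norm_sub_le _ _
      _ = 2 := by rw [norm_pow, hz, one_pow, norm_one]; norm_num
  have hlim := (hmean.const_sub 1).const_mul (z / (1 - z))
  rw [sub_zero, mul_one] at hlim
  refine hlim.congr' ?_
  filter_upwards [eventually_ne_atTop 0] with n hn using (eval_cesaroGeom hn hz1).symm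

lemma re_div_one_sub {z : ℂ} (hz : ‖z‖ = 1) (hz1 : z ≠ 1) : (z / (1 - z)).re = -1 / 2 := by
  have hz0 : z ≠ 0 := fun h => by simp [h] at hz
  have hsub : 1 - z ≠ 0 := sub_ne_zero.2 hz1.symm
  have hsub' : z - 1 ≠ 0 := sub_ne_zero.2 hz1
  have hsum : z / (1 - z) + z⁻¹ / (1 - z⁻¹) = -1 := by field_simp; ring
  have hre := congrArg Complex.re (Complex.add_conj (z / (1 - z)))
  rw [map_div₀, map_sub, map_one, ← Complex.inv_eq_conj hz, hsum, Complex.neg_re, Complex.one_re,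
    Complex.ofReal_re] at hre
  linarith

lemma coe_fourierChar_ne_one {x : ℝ} (hx : x ∈ Set.Ioo (0 : ℝ) 1) : (𝐞 x : ℂ) ≠ 1 := by
  rw [Real.fourierChar_apply, Ne, Complex.exp_eq_one_iff]
  rintro ⟨n, hn⟩
  have h : x = n := by
    have := mul_right_cancel₀ Complex.I_ne_zero
      (hn.trans (mul_assoc (n : ℂ) (2 * Real.pi) Complex.I).symm)
    norm_cast at this
    exact mul_left_cancel₀ Real.two_pi_pos.ne' (this.trans (mul_comm _ _))
  obtain ⟨h0, h1⟩ := hx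
  rw [h] at h0 h1
  norm_cast at h0 h1
  omega

/-- The idea is that `exp (A z / (1 - z))` has value `1` at `0` and modulus `exp (-A / 2)` on the
unit circle. -/
lemma exists_polynomial_approx_one {M : ℝ} (hM : 0 ≤ M) {δ : ℝ} (hδ : 0 < δ) :
    ∃ p : Polynomial ℂ, p.eval 0 = 0 ∧
      ∫ x in (0 : ℝ)..1, min 1 (M * ‖p.eval (𝐞 x : ℂ) - 1‖) < δ := by
  let w : ℝ → ℂ := fun x => 𝐞 x / (1 - 𝐞 x)
  have hw : Measurable w := by fun_prop
  obtain ⟨A, hA⟩ : ∃ A : ℝ, M * Real.exp (-A / 2) < δ := by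
    have lim := (Real.tendsto_exp_atBot.comp
      (tendsto_neg_atTop_atBot.atBot_div_const two_pos)).const_mul M
    rw [mul_zero] at lim
    exact ((tendsto_order.1 lim).2 δ hδ).exists
  have norm_exp_w {x : ℝ} (hx : x ∈ Set.Ioo (0 : ℝ) 1) :
      ‖Complex.exp (A * w x)‖ = Real.exp (-A / 2) := by
    rw [Complex.norm_exp, Complex.re_ofReal_mul,
      re_div_one_sub (Circle.norm_coe _) (coe_fourierChar_ne_one hx)]
    ring_nf
  obtain ⟨k, hk⟩ : ∃ k : ℕ, ∫ x in (0 : ℝ)..1, min 1 (M * ‖(1 + A * w x / k) ^ k‖) < δ := by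
    have lim := tendsto_integral_min_one (g := fun k x => M * ‖(1 + A * w x / k) ^ k‖)
      (g' := fun _ => M * Real.exp (-A / 2)) (fun k => by fun_prop) (fun k x => by positivity)
      fun x hx => by
        simpa only [norm_exp_w hx] using
          (Complex.tendsto_one_add_div_pow_exp (A * w x)).norm.const_mul M
    refine ((tendsto_order.1 lim).2 δ ?_).exists
    simpa using Or.inr hA
  have lim := tendsto_integral_min_one
    (g := fun n x => M * ‖(1 + A * (cesaroGeom n).eval (𝐞 x : ℂ) / k) ^ k‖)
    (g' := fun x => M * ‖(1 + A * w x / k) ^ k‖) (fun n => by fun_prop)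
    (fun n x => by positivity) fun x hx => by
      have hzn := tendsto_eval_cesaroGeom (Circle.norm_coe _) (coe_fourierChar_ne_one hx)
      exact ((((hzn.const_mul (A : ℂ)).div_const (k : ℂ)).const_add 1).pow k).norm.const_mul M
  obtain ⟨n, hn⟩ := ((tendsto_order.1 lim).2 δ hk).exists
  refine ⟨1 - (1 + Polynomial.C (A / k : ℂ) * cesaroGeom n) ^ k, by simp [eval_zero_cesaroGeom], ?_⟩
  refine lt_of_eq_of_lt (intervalIntegral.integral_congr fun x _ => ?_) hn
  simp [div_mul_eq_mul_div]

end PolynomialsNearOne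

section RieszProducts

lemma sqrt_one_add_le {y : ℝ} (hy : |y| ≤ 1) : √(1 + y) ≤ 1 + y / 2 - y ^ 2 / 16 := by
  obtain ⟨hy0, hy1⟩ := abs_le.1 hy
  refine Real.sqrt_le_iff.2 ⟨by nlinarith, ?_⟩
  nlinarith [sq_nonneg y, mul_nonneg (sq_nonneg y) (by linarith : 0 ≤ 1 - y), sq_nonneg (y ^ 2)]

lemma abs_mul_cos_le_one {r : ℝ} (hr : |r| ≤ 1) (θ : ℝ) : |r * Real.cos θ| ≤ 1 := by
  rw [abs_mul]; exact mul_le_one₀ hr (abs_nonneg _) (Real.abs_cos_le_one θ)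

lemma sqrt_one_add_mul_cos_le {r : ℝ} (hr : |r| ≤ 1) (θ : ℝ) :
    √(1 + r * Real.cos θ) ≤
      1 - r ^ 2 / 32 + r / 2 * Real.cos θ - r ^ 2 / 32 * Real.cos (2 * θ) := by
  refine (sqrt_one_add_le (abs_mul_cos_le_one hr θ)).trans_eq ?_
  rw [Real.cos_two_mul]; ring

lemma eventually_integral_mul_sqrt_one_add_cos_le {s : ℝ → ℝ} (hs : Continuous s)
    (hs0 : ∀ x, 0 ≤ s x) {r : ℝ} (hr0 : r ≠ 0) (hr1 : |r| ≤ 1) {J : ℝ} (hJ0 : 0 < J)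
    (hJ : ∫ x in (0 : ℝ)..1, s x ≤ J) :
    ∀ᶠ M : ℕ in atTop, ∫ x in (0 : ℝ)..1, s x * √(1 + r * Real.cos (2 * Real.pi * (M * x))) ≤
      (1 - r ^ 2 / 64) * J := by
  have hr2 : r ^ 2 ≤ 1 := (sq_le_one_iff_abs_le_one r).2 hr1
  have lim : Tendsto (fun M : ℕ =>
      r / 2 * (∫ x in (0 : ℝ)..1, s x * Real.cos (2 * Real.pi * (M * x))) - r ^ 2 / 32 *
        ∫ x in (0 : ℝ)..1, s x * Real.cos (2 * Real.pi * ((2 * M : ℕ) * x))) atTop (𝓝 0) := by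
    have h := tendsto_integral_mul_cos hs
    simpa using (h.const_mul (r / 2)).sub
      ((h.comp (tendsto_id.const_mul_atTop' two_pos)).const_mul (r ^ 2 / 32))
  filter_upwards [(tendsto_order.1 lim).2 (r ^ 2 / 64 * J) (by positivity)] with M hM
  have hint : IntervalIntegrable s volume 0 1 := hs.intervalIntegrable _ _
  have hintcos : ∀ N : ℕ, IntervalIntegrable (fun x => s x * Real.cos (2 * Real.pi * (N * x)))
      volume 0 1 := fun N => Continuous.intervalIntegrable (by fun_prop) _ _
  calc _ ≤ ∫ x in (0 : ℝ)..1, ((1 - r ^ 2 / 32) * s x +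
          (r / 2 * (s x * Real.cos (2 * Real.pi * (M * x))) -
            r ^ 2 / 32 * (s x * Real.cos (2 * Real.pi * ((2 * M : ℕ) * x))))) := by
        refine intervalIntegral.integral_mono_on zero_le_one
          (Continuous.intervalIntegrable (by fun_prop) _ _)
          (Continuous.intervalIntegrable (by fun_prop) _ _) fun x _ => ?_
        refine (mul_le_mul_of_nonneg_left (sqrt_one_add_mul_cos_le hr1 _) (hs0 x)).trans_eq ?_
        push_cast; ring_nf
    _ = (1 - r ^ 2 / 32) * (∫ x in (0 : ℝ)..1, s x) + _ := by
        rw [intervalIntegral.integral_add (hint.const_mul _)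
          (((hintcos _).const_mul _).sub ((hintcos _).const_mul _)), intervalIntegral.integral_sub
          ((hintcos _).const_mul _) ((hintcos _).const_mul _)]
        simp only [intervalIntegral.integral_const_mul]
    _ ≤ (1 - r ^ 2 / 32) * J + r ^ 2 / 64 * J :=
        add_le_add (mul_le_mul_of_nonneg_left hJ (by linarith)) hM.le
    _ = (1 - r ^ 2 / 64) * J := by ring

/-- The factor `1 + r cos (2 π x)`, as a Laurent polynomial in `exp (2 π i x)`, from whose dilations
Riesz products are built. -/
noncomputable def rieszFactor (r : ℝ) : ℂ[T;T⁻¹] :=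
  .single 0 1 + (.single 1 (r / 2 : ℂ) + .single (-1) (r / 2 : ℂ))

lemma trigEval_rieszFactor (x r : ℝ) :
    trigEval x (rieszFactor r) = (1 + r * Real.cos (2 * Real.pi * x) : ℝ) := by
  simp only [rieszFactor, map_add, trigEval_single, Real.fourierChar_apply]
  push_cast
  rw [Complex.cos, zero_mul, mul_zero, zero_mul, Complex.exp_zero]
  ring_nf

lemma coeff_rieszFactor_zero (r : ℝ) : (rieszFactor r).coeff 0 = 1 := by
  simp only [rieszFactor, AddMonoidAlgebra.coeff_add, AddMonoidAlgebra.coeff_single,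
    Finsupp.add_apply, Finsupp.single_apply]
  norm_num

lemma powSum_rieszFactor {p : ℝ} (hp : p ≠ 0) (r : ℝ) :
    powSum p (rieszFactor r).coeff = 1 + 2 * (|r| / 2) ^ p := by
  classical
  rw [rieszFactor, AddMonoidAlgebra.coeff_add, AddMonoidAlgebra.coeff_add, powSum_add_of_disjoint,
    powSum_add_of_disjoint]
  · simp only [AddMonoidAlgebra.coeff_single, powSum_single hp]
    rw [norm_one, Real.one_rpow, norm_div, Complex.norm_real, Complex.norm_two, Real.norm_eq_abs]
    ring
  · refine Finset.disjoint_of_subset_left Finsupp.support_single_subset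
      (Finset.disjoint_of_subset_right Finsupp.support_single_subset ?_)
    simp
  · refine Finset.disjoint_of_subset_left Finsupp.support_single_subset ?_
    rw [Finset.disjoint_singleton_left, Finsupp.notMem_support_iff]
    simp only [AddMonoidAlgebra.coeff_single, Finsupp.add_apply, Finsupp.single_apply]
    norm_num

lemma exists_riesz_product {r : ℝ} (hr0 : r ≠ 0) (hr1 : |r| ≤ 1) (K : ℕ) :
    ∃ P : ℂ[T;T⁻¹], P.coeff 0 = 1 ∧
      (∀ p : ℝ, p ≠ 0 → powSum p P.coeff = (1 + 2 * (|r| / 2) ^ p) ^ K) ∧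
      ∫ x in (0 : ℝ)..1, √‖trigEval x P‖ ≤ (1 - r ^ 2 / 64) ^ K := by
  induction K with
  | zero =>
    refine ⟨.single 0 1, by simp, fun p hp => ?_, by simp⟩
    rw [AddMonoidAlgebra.coeff_single, powSum_single hp]; simp
  | succ K ih =>
    obtain ⟨P, hP0, hPp, hPint⟩ := ih
    have hr2 : r ^ 2 ≤ 1 := (sq_le_one_iff_abs_le_one r).2 hr1
    obtain ⟨d, hd⟩ := exists_abs_le_of_mem_support P
    obtain ⟨L, hL, hLd⟩ := ((eventually_integral_mul_sqrt_one_add_cos_le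
      (s := fun x => √‖trigEval x P‖) (by fun_prop) (fun _ => Real.sqrt_nonneg _) hr0 hr1
      (pow_pos (by linarith) K) hPint).and (eventually_gt_atTop (2 * d))).exists
    have hLd' : (2 * d : ℤ) < L := by exact_mod_cast hLd
    refine ⟨P * dilate L (rieszFactor r), ?_, fun p hp => ?_, ?_⟩
    · rw [coeff_mul_dilate_zero hd hLd', hP0, coeff_rieszFactor_zero, mul_one]
    · rw [powSum_mul_dilate hd hLd' _ hp, hPp p hp, powSum_rieszFactor hp, pow_succ]
    · rw [pow_succ']
      convert hL using 4 with x
      have hcos := (abs_le.1 (abs_mul_cos_le_one hr1 (2 * Real.pi * (L * x)))).1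
      rw [map_mul, trigEval_dilate, trigEval_rieszFactor, norm_mul, Complex.norm_real,
        Int.cast_natCast, Real.norm_of_nonneg (by linarith), Real.sqrt_mul (norm_nonneg _)]

lemma min_one_le_sqrt {y : ℝ} (hy : 0 ≤ y) : min 1 y ≤ √y := by
  rcases le_total y 1 with h | h
  · exact (min_le_right _ _).trans (Real.le_sqrt_of_sq_le (by nlinarith))
  · exact (min_le_left _ _).trans (Real.one_le_sqrt.2 h)

lemma one_add_pow_le_exp {y : ℝ} (hy : 0 ≤ 1 + y) (K : ℕ) : (1 + y) ^ K ≤ Real.exp (K * y) := by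
  rw [Real.exp_nat_mul]
  exact pow_le_pow_left₀ hy (by linarith [Real.add_one_le_exp y]) _

lemma two_mul_half_rpow_le {r q : ℝ} (hr : 0 < r) (hq : 1 ≤ q) :
    2 * (r / 2) ^ q ≤ r ^ 2 * r ^ (q - 2) := by
  have htwo : (2 : ℝ) ≤ 2 ^ q := Real.self_le_rpow_of_one_le one_le_two hq
  calc 2 * (r / 2) ^ q = 2 / 2 ^ q * r ^ q := by rw [Real.div_rpow hr.le zero_le_two]; ring
    _ ≤ 1 * r ^ q := by gcongr; exact (div_le_one (by linarith)).2 htwo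
    _ = r ^ 2 * r ^ (q - 2) := by rw [one_mul, ← Real.rpow_two, ← Real.rpow_add hr]; congr 1; ring

lemma exists_mul_rpow_le {a A B : ℝ} (ha : 0 < a) (hB : 0 < B) :
    ∃ r : ℝ, 0 < r ∧ r ≤ 1 ∧ A * r ^ a ≤ B := by
  have lim : Tendsto (fun r : ℝ => A * r ^ a) (𝓝[>] 0) (𝓝 0) := by
    simpa [Real.zero_rpow ha.ne'] using ((Real.continuousAt_rpow_const 0 a
      (Or.inr ha.le)).tendsto.const_mul A).mono_left (nhdsWithin_le_nhds (s := Set.Ioi 0))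
  obtain ⟨r, hr, hr01⟩ :=
    (((tendsto_order.1 lim).2 B hB).and (Ioc_mem_nhdsGT one_pos)).exists
  exact ⟨r, hr01.1, hr01.2, hr.le⟩

lemma exists_nat_mul_mem_Icc {A s : ℝ} (hA : 0 ≤ A) (hs0 : 0 < s) (hs1 : s ≤ 1) :
    ∃ K : ℕ, A ≤ K * s ∧ K * s ≤ A + 1 := by
  refine ⟨⌈A / s⌉₊, (div_le_iff₀ hs0).1 (Nat.le_ceil _), ?_⟩
  calc ⌈A / s⌉₊ * s ≤ (A / s + 1) * s := by gcongr; exact (Nat.ceil_lt_add_one (by positivity)).le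
    _ = A + s := by field_simp
    _ ≤ A + 1 := by linarith

/-- A Riesz product with `K` factors of amplitude `r` is small in measure as soon as `K r ^ 2` is
large, while its `ℓ^q` norm for `q > 2` stays close to `1` when `K r ^ q` is small. -/
lemma exists_trigEval_small {q : ℝ} (hq : 2 < q) {η : ℝ} (hη : 0 < η) :
    ∃ E : ℝ, ∀ κ : ℝ, 0 < κ → ∃ P : ℂ[T;T⁻¹], P.coeff 0 = 1 ∧
      ∫ x in (0 : ℝ)..1, min 1 ‖trigEval x P‖ ≤ η ∧
      powSum 2 P.coeff ≤ E ∧ powSum q P.coeff ≤ 1 + κ := by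
  obtain ⟨A, hA0, hA⟩ : ∃ A : ℝ, 0 ≤ A ∧ Real.exp (-(A / 64)) ≤ η := by
    refine ⟨64 * |Real.log η|, by positivity, ?_⟩
    rw [← Real.le_log_iff_exp_le hη]
    linarith [neg_abs_le (Real.log η)]
  refine ⟨Real.exp ((A + 1) / 2), fun κ hκ => ?_⟩
  obtain ⟨r, hr0, hr1, hr⟩ := exists_mul_rpow_le (A := A + 1) (sub_pos.2 hq)
    (Real.log_pos (lt_add_of_pos_right 1 hκ))
  obtain ⟨K, hAK, hKA⟩ := exists_nat_mul_mem_Icc hA0 (pow_pos hr0 2) (pow_le_one₀ hr0.le hr1)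
  obtain ⟨P, hP0, hP, hint⟩ := exists_riesz_product hr0.ne' (by rwa [abs_of_pos hr0]) K
  rw [abs_of_pos hr0] at hP
  refine ⟨P, hP0, ?_, ?_, ?_⟩
  · calc ∫ x in (0 : ℝ)..1, min 1 ‖trigEval x P‖ ≤ ∫ x in (0 : ℝ)..1, √‖trigEval x P‖ :=
          intervalIntegral.integral_mono_on zero_le_one
            (Continuous.intervalIntegrable (by fun_prop) _ _)
            (Continuous.intervalIntegrable (by fun_prop) _ _)
            fun x _ => min_one_le_sqrt (norm_nonneg _)
      _ ≤ (1 + -(r ^ 2 / 64)) ^ K := by rwa [← sub_eq_add_neg]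
      _ ≤ Real.exp (K * -(r ^ 2 / 64)) := one_add_pow_le_exp (by nlinarith) K
      _ ≤ Real.exp (-(A / 64)) := Real.exp_le_exp.2 (by linarith)
      _ ≤ η := hA
  · rw [hP 2 two_ne_zero, Real.rpow_two]
    exact (one_add_pow_le_exp (by positivity) K).trans (Real.exp_le_exp.2 (by linarith))
  · rw [hP q (by linarith)]
    refine (one_add_pow_le_exp (by positivity) K).trans
      ((Real.le_log_iff_exp_le (by linarith)).1 (le_trans ?_ hr))
    calc K * (2 * (r / 2) ^ q) ≤ K * (r ^ 2 * r ^ (q - 2)) :=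
          mul_le_mul_of_nonneg_left (two_mul_half_rpow_le hr0 (by linarith)) (Nat.cast_nonneg K)
      _ = K * r ^ 2 * r ^ (q - 2) := by ring
      _ ≤ (A + 1) * r ^ (q - 2) := by gcongr

end RieszProducts

section SmallCoefficients

lemma min_one_norm_add_mul_le (u v τ : ℂ) {M : ℝ} (hM : 0 < M) :
    min 1 ‖u + v * τ‖ ≤ min 1 ‖u‖ + min 1 (M * ‖τ‖) + ‖v‖ ^ 2 / M ^ 2 := by
  have hv : min 1 (‖v‖ * ‖τ‖) ≤ min 1 (M * ‖τ‖) + ‖v‖ ^ 2 / M ^ 2 := by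
    rcases le_total ‖v‖ M with h | h
    · exact le_add_of_le_of_nonneg (by gcongr) (by positivity)
    · exact (min_le_left _ _).trans (le_add_of_nonneg_of_le (by positivity)
        ((one_le_div (by positivity)).2 (by gcongr)))
  calc min 1 ‖u + v * τ‖ ≤ min 1 (‖u‖ + ‖v‖ * ‖τ‖) := by
        gcongr; exact (norm_add_le _ _).trans_eq (by rw [norm_mul])
    _ ≤ min 1 ‖u‖ + min 1 (‖v‖ * ‖τ‖) := min_one_add_le (norm_nonneg _) (by positivity)
    _ ≤ min 1 ‖u‖ + min 1 (M * ‖τ‖) + ‖v‖ ^ 2 / M ^ 2 := by rw [add_assoc]; gcongr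

lemma integral_min_one_norm_add_mul_le (P B : ℂ[T;T⁻¹]) (t : Polynomial ℂ) {L : ℤ} (hL : L ≠ 0)
    {M : ℝ} (hM : 0 < M) :
    ∫ x in (0 : ℝ)..1, min 1 ‖trigEval x P + trigEval x B * (t.eval (𝐞 (L * x) : ℂ) - 1)‖ ≤
      (∫ x in (0 : ℝ)..1, min 1 ‖trigEval x P‖) +
        (∫ x in (0 : ℝ)..1, min 1 (M * ‖t.eval (𝐞 x : ℂ) - 1‖)) + powSum 2 B.coeff / M ^ 2 := by
  have hper : Function.Periodic (fun x : ℝ => min 1 (M * ‖t.eval (𝐞 x : ℂ) - 1‖)) 1 := fun x => by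
    simp only [fourierChar_add_one]
  have hdil := integral_comp_intCast_mul_of_periodic (by fun_prop) hper hL 0 1
  simp only [Int.cast_zero, Int.cast_one, sub_zero, one_mul] at hdil
  have hP : IntervalIntegrable (fun x => min 1 ‖trigEval x P‖) volume 0 1 :=
    Continuous.intervalIntegrable (by fun_prop) _ _
  have ht : IntervalIntegrable (fun x : ℝ => min 1 (M * ‖t.eval (𝐞 (L * x) : ℂ) - 1‖))
    volume 0 1 := Continuous.intervalIntegrable (by fun_prop) _ _
  have hB : IntervalIntegrable (fun x => ‖trigEval x B‖ ^ 2 / M ^ 2) volume 0 1 :=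
    Continuous.intervalIntegrable (by fun_prop) _ _
  calc _ ≤ ∫ x in (0 : ℝ)..1, (min 1 ‖trigEval x P‖ +
          min 1 (M * ‖t.eval (𝐞 (L * x) : ℂ) - 1‖) + ‖trigEval x B‖ ^ 2 / M ^ 2) :=
        intervalIntegral.integral_mono_on zero_le_one
          (Continuous.intervalIntegrable (by fun_prop) _ _) ((hP.add ht).add hB)
          fun x _ => min_one_norm_add_mul_le _ _ _ hM
    _ = _ := by
        rw [intervalIntegral.integral_add (hP.add ht) hB, intervalIntegral.integral_add hP ht,
          intervalIntegral.integral_div, integral_norm_sq_trigEval, hdil]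

lemma exists_pos_add_one_add_neg {P : ℂ[T;T⁻¹]} (hP : P.coeff 0 = 1) :
    ∃ A B : ℂ[T;T⁻¹], A + 1 + B = P ∧
      (∀ n ∈ A.coeff.support, n ∈ P.coeff.support ∧ 0 < n) ∧
      (∀ n ∈ B.coeff.support, n ∈ P.coeff.support ∧ n < 0) ∧
      ∀ p : ℝ, p ≠ 0 → powSum p A.coeff + 1 + powSum p B.coeff = powSum p P.coeff := by
  set c := P.coeff
  have hsplit : c.filter (0 < ·) + Finsupp.single 0 1 + c.filter (· < 0) = c := by
    ext n
    rcases lt_trichotomy n 0 with h | rfl | h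
    · simp [h, h.not_gt, h.ne]
    · simp [hP]
    · simp [h, h.not_gt, h.ne']
  refine ⟨.ofCoeff (c.filter (0 < ·)), .ofCoeff (c.filter (· < 0)), ?_, ?_, ?_, fun p hp => ?_⟩
  · exact AddMonoidAlgebra.coeff_injective hsplit
  · intro n hn
    simpa [Finsupp.support_filter] using hn
  · intro n hn
    simpa [Finsupp.support_filter] using hn
  · conv_rhs => rw [← hsplit]
    rw [powSum_add_of_disjoint, powSum_add_of_disjoint, powSum_single hp, norm_one, Real.one_rpow]
    · refine Finset.disjoint_left.2 fun n hn => ?_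
      simp only [Finsupp.support_filter, Finset.mem_filter, Finsupp.mem_support_single] at hn ⊢
      omega
    · refine Finset.disjoint_left.2 fun n hn => ?_
      have hn' := Finsupp.support_add hn
      simp only [Finsupp.support_filter, Finset.mem_union, Finset.mem_filter,
        Finsupp.mem_support_single] at hn' ⊢
      omega

lemma pos_of_mem_support_toLaurent {t : Polynomial ℂ} (ht : t.eval 0 = 0) {n : ℤ}
    (hn : n ∈ t.toLaurent.coeff.support) : 0 < n := by
  rw [LaurentPolynomial.support_coeff_toLaurent, Finset.mem_map] at hn
  obtain ⟨m, hm, rfl⟩ := hn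
  refine Int.natCast_pos.2 (Nat.pos_of_ne_zero ?_)
  rintro rfl
  exact Polynomial.mem_support_iff.1 hm (by rwa [Polynomial.coeff_zero_eq_eval_zero])

lemma one_sub_trigEval_neg_add_mul_dilate (x : ℝ) (A B : ℂ[T;T⁻¹]) (L : ℤ) (t : Polynomial ℂ) :
    1 - trigEval x (-(A + B * dilate L t.toLaurent)) =
      trigEval x (A + 1 + B) + trigEval x B * (t.eval (𝐞 (L * x) : ℂ) - 1) := by
  rw [← trigEval_toLaurent, ← trigEval_dilate]
  simp only [map_neg, map_add, map_mul, map_one]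
  ring

/-- With `P = A + 1 + B` split into its parts of positive, zero and negative frequencies, one takes
`Q = -(A + B t(T ^ L))`: since `t` is close to `1` in measure, `1 - Q` is close to `P`, and
multiplication by `t(T ^ L)` makes all frequencies of `B` positive. -/
lemma exists_trigEval_approx_one {q : ℝ} (hq : 2 < q) {δ : ℝ} (hδ : 0 < δ) :
    ∃ Q : ℂ[T;T⁻¹], (∀ n ∈ Q.coeff.support, 0 < n) ∧ powSum q Q.coeff ≤ δ ∧
      ∫ x in (0 : ℝ)..1, min 1 ‖1 - trigEval x Q‖ ≤ δ := by
  have hq0 : q ≠ 0 := by linarith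
  obtain ⟨E, hE⟩ := exists_trigEval_small hq (η := δ / 4) (by positivity)
  obtain ⟨M, hM0, hM⟩ : ∃ M : ℝ, 0 < M ∧ E / M ^ 2 < δ / 4 :=
    ((eventually_gt_atTop 0).and ((tendsto_order.1 (tendsto_const_nhds.div_atTop
      (tendsto_pow_atTop two_ne_zero))).2 (δ / 4) (by positivity))).exists
  obtain ⟨t, ht0, ht⟩ := exists_polynomial_approx_one hM0.le (δ := δ / 4) (by positivity)
  set W := powSum q t.toLaurent.coeff
  have hW : 0 ≤ W := powSum_nonneg _ _
  obtain ⟨P, hP0, hPint, hP2, hPq⟩ := hE (δ / (1 + W)) (by positivity)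
  obtain ⟨A, B, hABP, hA, hB, hAB⟩ := exists_pos_add_one_add_neg hP0
  obtain ⟨d, hd⟩ := exists_abs_le_of_mem_support P
  set L : ℤ := 2 * d + 1
  have hBd : ∀ n ∈ B.coeff.support, |n| ≤ d := fun n hn => hd n (hB n hn).1
  have hfar : ∀ n ∈ (B * dilate L t.toLaurent).coeff.support, (d : ℤ) < n := fun n =>
    lt_of_mem_support_mul_dilate hBd (lt_add_one _) fun m => pos_of_mem_support_toLaurent ht0
  refine ⟨-(A + B * dilate L t.toLaurent), fun n hn => ?_, ?_, ?_⟩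
  · rw [AddMonoidAlgebra.coeff_neg, Finsupp.support_neg] at hn
    rcases Finset.mem_union.1 (Finsupp.support_add hn) with h | h
    · exact (hA n h).2
    · exact (Nat.cast_nonneg d).trans_lt (hfar n h)
  · rw [AddMonoidAlgebra.coeff_neg, powSum_neg, AddMonoidAlgebra.coeff_add, powSum_add_of_disjoint,
      powSum_mul_dilate hBd (lt_add_one _) _ hq0]
    · have hA0 := powSum_nonneg q A.coeff
      have hB0 := powSum_nonneg q B.coeff
      have hAB' : powSum q A.coeff + powSum q B.coeff ≤ δ / (1 + W) := by linarith [hAB q hq0]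
      calc powSum q A.coeff + powSum q B.coeff * W
          ≤ (powSum q A.coeff + powSum q B.coeff) * (1 + W) := by nlinarith
        _ ≤ δ := (le_div_iff₀ (by positivity)).1 hAB'
    · exact Finset.disjoint_left.2 fun n hn hn' =>
        (hfar n hn').not_ge ((abs_le.1 (hd n (hA n hn).1)).2)
  · simp_rw [one_sub_trigEval_neg_add_mul_dilate, hABP]
    have hB2 : powSum 2 B.coeff / M ^ 2 ≤ E / M ^ 2 := by
      gcongr
      linarith [hAB 2 two_ne_zero, powSum_nonneg 2 A.coeff]
    linarith [integral_min_one_norm_add_mul_le P B t (L := L) (by omega) hM0]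

lemma exists_finsupp_approx_one {q : ℝ} (hq : 2 < q) {δ : ℝ} (hδ : 0 < δ) :
    ∃ c : ℕ →₀ ℂ, c 0 = 0 ∧ powSum q c ≤ δ ∧
      ∫ x in (0 : ℝ)..1, min 1 ‖1 - c.sum fun n z => z * 𝐞 (n * x)‖ ≤ δ := by
  obtain ⟨Q, hQpos, hQq, hQint⟩ := exists_trigEval_approx_one hq hδ
  have hbij : Set.BijOn (Nat.cast : ℕ → ℤ) (Nat.cast ⁻¹' (Q.coeff.support : Set ℤ))
      Q.coeff.support :=
    ⟨fun _ h => h, Nat.cast_injective.injOn, fun n hn =>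
      ⟨n.toNat, by simpa [Int.toNat_of_nonneg (hQpos n hn).le] using hn,
        Int.toNat_of_nonneg (hQpos n hn).le⟩⟩
  refine ⟨Q.coeff.comapDomain Nat.cast hbij.injOn, ?_, ?_, ?_⟩
  · by_contra h
    exact (hQpos 0 (Finsupp.mem_support_iff.2 h)).false
  · exact (Finsupp.sum_comapDomain _ _ (fun _ z => ‖z‖ ^ q) hbij).trans_le hQq
  · have hsum : ∀ x : ℝ, ((Q.coeff.comapDomain Nat.cast hbij.injOn).sum
        fun n z => z * (𝐞 (n * x) : ℂ)) = trigEval x Q := fun x => by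
      rw [trigEval_eq_sum]
      simpa only [Function.comp_def, Int.cast_natCast] using
        Finsupp.sum_comapDomain _ _ (fun (n : ℤ) z => z * (𝐞 (n * x) : ℂ)) hbij
    simp_rw [hsum]
    exact hQint

end SmallCoefficients

section QuasiLacunary

lemma exists_block_positions {ε : ℕ → ℝ} (hε : Tendsto ε atTop (𝓝 0)) (D : ℕ → ℕ) :
    ∃ N : ℕ → ℕ, (∀ j, N j + D j ≤ N (j + 1)) ∧ ∀ j, ∀ n ≥ N j, ε n * (D j + 1) ≤ 1 / 2 := by
  have hsmall : ∀ j, ∃ t, ∀ n ≥ t, ε n * (D j + 1) ≤ 1 / 2 := fun j => by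
    have lim := hε.mul_const ((D j : ℝ) + 1)
    rw [zero_mul] at lim
    exact eventually_atTop.1 (lim.eventually_le_const one_half_pos)
  choose t ht using hsmall
  refine ⟨fun j => ∑ i ∈ Finset.range j, D i + ∑ i ∈ Finset.range (j + 1), t i, fun j => ?_,
    fun j n hn => ht j n ?_⟩
  · simp only [Finset.sum_range_succ]; omega
  · simp only [Finset.sum_range_succ] at hn; omega

variable {D N : ℕ → ℕ}

lemma eq_of_mem_Ioc_block (hN : ∀ j, N j + D j ≤ N (j + 1)) {j j' n : ℕ}
    (h : n ∈ Set.Ioc (N j) (N j + D j)) (h' : n ∈ Set.Ioc (N j') (N j' + D j')) : j = j' := by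
  have hmono : Monotone N := monotone_nat_of_le_succ fun j => (Nat.le_add_right _ _).trans (hN j)
  have key : ∀ {a b}, n ∈ Set.Ioc (N a) (N a + D a) → n ∈ Set.Ioc (N b) (N b + D b) → ¬a < b :=
    fun {a b} ha hb hab =>
      (ha.2.trans ((hN a).trans (hmono (Nat.succ_le_of_lt hab)))).not_gt hb.1
  exact le_antisymm (not_lt.1 (key h' h)) (not_lt.1 (key h h'))

lemma exists_block_coordinates (hN : ∀ j, N j + D j ≤ N (j + 1)) (k : ℕ → ℝ) :
    ∃ (κ : ℕ → ℝ) (m : ℕ → ℕ), (∀ n, 1 ≤ m n) ∧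
      ∀ j, ∀ i ∈ Set.Ioc 0 (D j), κ (N j + i) = k j ∧ m (N j + i) = i := by
  classical
  have hcoord : ∀ n, ∃ u : ℝ × ℕ, 1 ≤ u.2 ∧
      ∀ j, ∀ i ∈ Set.Ioc 0 (D j), N j + i = n → (k j, i) = u := fun n => by
    by_cases h : ∃ j, n ∈ Set.Ioc (N j) (N j + D j)
    · obtain ⟨j, hj⟩ := h
      refine ⟨(k j, n - N j), Nat.sub_pos_of_lt hj.1, ?_⟩
      rintro j' i hi rfl
      obtain rfl := eq_of_mem_Ioc_block hN hj (j' := j')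
        ⟨Nat.lt_add_of_pos_right hi.1, Nat.add_le_add_left hi.2 _⟩
      rw [Nat.add_sub_cancel_left]
    · refine ⟨(0, 1), le_rfl, fun j i hi hn => (h ⟨j, ?_⟩).elim⟩
      exact hn ▸ ⟨Nat.lt_add_of_pos_right hi.1, Nat.add_le_add_left hi.2 _⟩
  choose u hu huk using hcoord
  refine ⟨fun n => (u n).1, fun n => (u n).2, hu, fun j i hi => ?_⟩
  simp [← huk _ j i hi rfl]

lemma exists_scales (κ : ℕ → ℝ) (G : ℕ → ℝ → ℝ) (cont : ℕ → Prop)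
    (hκ : ∀ n, cont n → κ (n + 1) = κ n) :
    ∃ ρ : ℕ → ℕ, (∀ n, |κ n| + 2 ≤ ρ n) ∧ (∀ n, cont n → ρ (n + 1) = ρ n) ∧
      ∀ n, ¬cont n → G n (ρ n) + |κ (n + 1)| ≤ ρ (n + 1) := by
  classical
  obtain ⟨ρ, hρ0, hρ⟩ : ∃ ρ : ℕ → ℕ, ρ 0 = ⌈|κ 0| + 2⌉₊ ∧ ∀ n, ρ (n + 1) =
      if cont n then ρ n else ⌈|G n (ρ n)| + |κ (n + 1)| + 2⌉₊ :=
    ⟨fun n => n.rec ⌈|κ 0| + 2⌉₊ fun n r => if cont n then r else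
      ⌈|G n r| + |κ (n + 1)| + 2⌉₊, rfl, fun _ => rfl⟩
  have hjump : ∀ n, ¬cont n → |G n (ρ n)| + |κ (n + 1)| + 2 ≤ ρ (n + 1) := fun n hn => by
    rw [hρ, if_neg hn]; exact Nat.le_ceil _
  refine ⟨ρ, fun n => ?_, fun n hn => by rw [hρ, if_pos hn], fun n hn => ?_⟩
  · induction n with
    | zero => rw [hρ0]; exact Nat.le_ceil _
    | succ n ih =>
      by_cases hn : cont n
      · rwa [hρ, if_pos hn, hκ n hn]
      · linarith [hjump n hn, abs_nonneg (G n (ρ n))]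
  · linarith [hjump n hn, le_abs_self (G n (ρ n))]

lemma growth_of_mul_le_half {ε κ ρ m : ℝ} (hε : 0 ≤ ε) (hκ : |κ| + 2 ≤ ρ)
    (hm : ε * (m + 1) ≤ 1 / 2) : (1 + ε) * (κ + ρ * m) + 1 ≤ κ + ρ * (m + 1) := by
  have hεκ : ε * κ ≤ ε * ρ := by
    gcongr; linarith [le_abs_self κ]
  have hρm : ρ * (ε * (m + 1)) ≤ ρ * (1 / 2) := by
    gcongr; linarith [abs_nonneg κ]
  linarith [abs_nonneg κ]

/-- Within a progression the `i`-th ratio exceeds `1` by about `1 / i ≥ 1 / D j`, so the growth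
condition holds as soon as the progression sits at indices where `ε` is small; between progressions
it is ensured by enlarging the step. -/
lemma exists_quasiLacunary_blocks {ε : ℕ → ℝ} (hε0 : ∀ n, 0 ≤ ε n) (hε : Tendsto ε atTop (𝓝 0))
    (D : ℕ → ℕ) (k : ℕ → ℝ) :
    ∃ (lam : ℕ → ℝ) (N R : ℕ → ℕ), (∀ n, 0 < lam n) ∧
      (∀ n, (1 + ε n) * lam n + 1 ≤ lam (n + 1)) ∧ (∀ j, N j + D j ≤ N (j + 1)) ∧
      ∀ j, R j ≠ 0 ∧ ∀ i ∈ Set.Ioc 0 (D j), lam (N j + i) = k j + R j * i := by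
  obtain ⟨N, hN, hNε⟩ := exists_block_positions hε D
  obtain ⟨κ, m, hm, hκm⟩ := exists_block_coordinates hN k
  have hcont : ∀ n, (∃ j, ∃ i ∈ Set.Ico 1 (D j), n = N j + i) →
      κ (n + 1) = κ n ∧ m (n + 1) = m n + 1 ∧ ε n * (m n + 1) ≤ 1 / 2 := by
    rintro _ ⟨j, i, ⟨hi1, hiD⟩, rfl⟩
    obtain ⟨hκ, hmi⟩ := hκm j i ⟨hi1, hiD.le⟩
    obtain ⟨hκ', hmi'⟩ := hκm j (i + 1) ⟨i.succ_pos, hiD⟩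
    refine ⟨hκ'.trans hκ.symm, by rw [add_assoc, hmi', hmi], ?_⟩
    refine le_trans ?_ (hNε j (N j + i) (Nat.le_add_right _ _))
    rw [hmi]
    have := hε0 (N j + i)
    gcongr
  obtain ⟨ρ, hρ, hρcont, hρjump⟩ := exists_scales κ
    (fun n r => (1 + ε n) * (κ n + r * m n) + 1) _ fun n hn => (hcont n hn).1
  have hρ0 : ∀ n, 0 < (ρ n : ℝ) := fun n => by linarith [hρ n, abs_nonneg (κ n)]
  have hlow : ∀ n, ρ n - |κ n| ≤ κ n + ρ n * m n := fun n => by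
    linarith [neg_abs_le (κ n), le_mul_of_one_le_right (hρ0 n).le (Nat.one_le_cast.2 (hm n))]
  refine ⟨fun n => κ n + ρ n * m n, N, fun j => ρ (N j + 1), fun n => ?_, fun n => ?_, hN,
    fun j => ⟨(Nat.cast_pos.1 (hρ0 _)).ne', fun i hi => ?_⟩⟩
  · linarith [hlow n, hρ n]
  · by_cases hn : ∃ j, ∃ i ∈ Set.Ico 1 (D j), n = N j + i
    · obtain ⟨hκ, hmn, hmε⟩ := hcont n hn
      simp only [hκ, hmn, hρcont n hn, Nat.cast_add, Nat.cast_one]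
      exact growth_of_mul_le_half (hε0 n) (hρ n) hmε
    · linarith [hρjump n hn, hlow (n + 1)]
  · have hconst : ρ (N j + i) = ρ (N j + 1) := by
      induction i, hi.1 using Nat.le_induction with
      | base => rfl
      | succ i h1 ih =>
        rw [← ih ⟨h1, (Nat.le_succ i).trans hi.2⟩, ← hρcont _ ⟨j, i, ⟨h1, hi.2⟩, rfl⟩, add_assoc]
    simp only [(hκm j i hi).1, (hκm j i hi).2, hconst]

lemma abs_natCast_sub_le_of_add_one_le {lam : ℕ → ℝ} (h : ∀ n, lam n + 1 ≤ lam (n + 1))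
    (m n : ℕ) : |(m : ℝ) - n| ≤ |lam m - lam n| := by
  have hmono : Monotone fun n => lam n - n := monotone_nat_of_le_succ fun n => by
    push_cast
    linarith [h n]
  wlog hle : n ≤ m generalizing m n
  · rw [abs_sub_comm, abs_sub_comm (lam m)]
    exact this n m (le_of_not_ge hle)
  · rw [abs_of_nonneg (sub_nonneg.2 (Nat.cast_le.2 hle))]
    linarith [hmono hle, le_abs_self (lam m - lam n)]

lemma UniformlyDiscrete.of_add_one_le {lam : ℕ → ℝ} (h : ∀ n, lam n + 1 ≤ lam (n + 1)) :
    UniformlyDiscrete lam := by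
  refine ⟨1, one_pos, fun m n hmn => le_trans ?_ (abs_natCast_sub_le_of_add_one_le h m n)⟩
  exact_mod_cast Int.one_le_abs (sub_ne_zero.2 (Nat.cast_injective.ne hmn))

end QuasiLacunary

section SmallCoefficientCombinations

variable {H ι κ : Type*} [NormedAddCommGroup H] [NormedSpace ℂ H]

lemma exists_seq_frequently_eq (κ : Type*) [Countable κ] [Nonempty κ] :
    ∃ k : ℕ → κ, ∀ r, ∃ᶠ j in atTop, k j = r := by
  obtain ⟨e, he⟩ := exists_surjective_nat κ
  refine ⟨fun j => e j.unpair.1, fun r => frequently_atTop.2 fun J => ?_⟩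
  obtain ⟨n, rfl⟩ := he r
  exact ⟨Nat.pair n J, Nat.right_le_pair _ _, by simp only [Nat.unpair_pair]⟩

lemma tendsto_powSum {b : ℕ → ι →₀ ℂ}
    (hb : ∀ j : ℕ, powSum (2 + 1 / ((j : ℝ) + 1)) (b j) ≤ (1 / 2) ^ j) {q : ℝ} (hq : 2 < q) :
    Tendsto (fun j => powSum q (b j)) atTop (𝓝 0) := by
  have hexp : ∀ᶠ j : ℕ in atTop, 1 / ((j : ℝ) + 1) ≤ q - 2 :=
    tendsto_one_div_add_atTop_nhds_zero_nat.eventually_le_const (by linarith)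
  refine squeeze_zero' (Eventually.of_forall fun j => powSum_nonneg q _) ?_
    (tendsto_pow_atTop_nhds_zero_of_lt_one one_half_pos.le one_half_lt_one)
  filter_upwards [hexp] with j hj
  have hle : powSum (2 + 1 / ((j : ℝ) + 1)) (b j) ≤ 1 :=
    (hb j).trans (pow_le_one₀ one_half_pos.le one_half_lt_one.le)
  exact (powSum_le_of_exponent_le (by positivity) (by linarith) hle).trans (hb j)

lemma powSum_sum_smul_of_pairwiseDisjoint {p : ℝ} (hp : p ≠ 0) {s : Finset κ} {b : κ → ι →₀ ℂ}
    (hb : (s : Set κ).PairwiseDisjoint fun r => (b r).support) (a : κ → ℂ) :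
    powSum p (∑ r ∈ s, a r • b r) = ∑ r ∈ s, ‖a r‖ ^ p * powSum p (b r) := by
  simp only [← powSum_smul hp]
  refine sum_finsetSum_of_pairwiseDisjoint (fun r hr r' hr' h => ?_) _
  exact (hb hr hr' h).mono Finsupp.support_smul Finsupp.support_smul

variable {v : ι → H} {y : κ → H} {b : ℕ → ι →₀ ℂ} {k : ℕ → κ}

lemma exists_linearCombination_approx_sum
    (hb : Pairwise fun i j => Disjoint (b i).support (b j).support)
    (hk : ∀ r, ∃ᶠ j in atTop, k j = r)
    (hby : Tendsto (fun j => y (k j) - Finsupp.linearCombination ℂ v (b j)) atTop (𝓝 0))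
    {q : ℝ} (hq : q ≠ 0) (hbq : Tendsto (fun j => powSum q (b j)) atTop (𝓝 0)) (a : κ →₀ ℂ)
    {θ : ℝ} (hθ : 0 < θ) :
    ∃ c : ι →₀ ℂ, ‖(a.sum fun r z => z • y r) - Finsupp.linearCombination ℂ v c‖ ≤
      (∑ r ∈ a.support, ‖a r‖) * θ ∧ powSum q c ≤ powSum q a * θ := by
  have hnorm := tendsto_zero_iff_norm_tendsto_zero.1 hby
  have hgood : ∀ r, ∃ j, k j = r ∧
      ‖y (k j) - Finsupp.linearCombination ℂ v (b j)‖ ≤ θ ∧ powSum q (b j) ≤ θ := fun r =>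
    ((hk r).and_eventually <| (hnorm.eventually_le_const hθ).and
      (hbq.eventually_le_const hθ)).exists
  choose j hjk hjy hjq using hgood
  simp only [hjk] at hjy
  have hj : Function.Injective j := Function.LeftInverse.injective hjk
  refine ⟨∑ r ∈ a.support, a r • b (j r), ?_, ?_⟩
  · simp only [map_sum, map_smul, Finsupp.sum, ← Finset.sum_sub_distrib, ← smul_sub]
    rw [Finset.sum_mul]
    exact norm_sum_le_of_le _ fun r _ =>
      (norm_smul_le _ _).trans (mul_le_mul_of_nonneg_left (hjy r) (norm_nonneg _))
  · rw [powSum_sum_smul_of_pairwiseDisjoint hq fun r _ r' _ h => hb (hj.ne h), powSum,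
      Finsupp.sum_mul]
    exact Finset.sum_le_sum fun r _ => mul_le_mul_of_nonneg_left (hjq r) (by positivity)

/-- Each `y r` can be replaced by infinitely many disjointly supported combinations, so the
`ℓ^q` sum of the coefficients can be made small without any control on the expansion of `f` in
terms of `y`. -/
lemma exists_linearCombination_approx
    (hy : (Submodule.span ℂ (Set.range y)).topologicalClosure = ⊤)
    (hb : Pairwise fun i j => Disjoint (b i).support (b j).support)
    (hk : ∀ r, ∃ᶠ j in atTop, k j = r)
    (hby : Tendsto (fun j => y (k j) - Finsupp.linearCombination ℂ v (b j)) atTop (𝓝 0))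
    {q : ℝ} (hq : q ≠ 0) (hbq : Tendsto (fun j => powSum q (b j)) atTop (𝓝 0)) (f : H)
    {η ρ : ℝ} (hη : 0 < η) (hρ : 0 < ρ) :
    ∃ c : ι →₀ ℂ, ‖f - Finsupp.linearCombination ℂ v c‖ < η ∧ powSum q c ≤ ρ := by
  have hf : f ∈ (Submodule.span ℂ (Set.range y)).topologicalClosure := hy ▸ Submodule.mem_top
  obtain ⟨_, hs, hfs⟩ := Metric.mem_closure_iff.1 hf (η / 2) (half_pos hη)
  obtain ⟨a, rfl⟩ := Finsupp.mem_span_range_iff_exists_finsupp.1 hs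
  rw [dist_eq_norm] at hfs
  have hsmall (C : ℝ) {B : ℝ} (hB : 0 < B) : ∀ᶠ θ in 𝓝[>] (0 : ℝ), C * θ < B := by
    have lim : Tendsto (fun θ => C * θ) (𝓝[>] (0 : ℝ)) (𝓝 (C * 0)) :=
      (tendsto_id.const_mul C).mono_left nhdsWithin_le_nhds
    rw [mul_zero] at lim
    exact lim.eventually_lt_const hB
  obtain ⟨θ, ⟨hθη, hθρ⟩, hθ⟩ := (((hsmall (∑ r ∈ a.support, ‖a r‖) (half_pos hη)).and
    (hsmall (powSum q a) hρ)).and self_mem_nhdsWithin).exists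
  obtain ⟨c, hc, hcq⟩ := exists_linearCombination_approx_sum hb hk hby hq hbq a hθ
  refine ⟨c, ?_, hcq.trans hθρ.le⟩
  linarith [norm_sub_le_norm_sub_add_norm_sub f (a.sum fun r z => z • y r)
    (Finsupp.linearCombination ℂ v c)]

end SmallCoefficientCombinations

section BesselInequality

lemma sum_mul_mul_le_of_symm {ι : Type*} {s : Finset ι} {K : ι → ι → ℝ} {C : ℝ}
    (hK : ∀ i j, 0 ≤ K i j) (hsymm : ∀ i j, K i j = K j i) (hC : ∀ i, ∑ j ∈ s, K i j ≤ C)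
    (a : ι → ℝ) : ∑ i ∈ s, ∑ j ∈ s, a i * a j * K i j ≤ C * ∑ i ∈ s, a i ^ 2 := by
  have hrow : ∑ i ∈ s, ∑ j ∈ s, a i ^ 2 * K i j ≤ C * ∑ i ∈ s, a i ^ 2 := by
    rw [Finset.mul_sum]
    refine Finset.sum_le_sum fun i _ => ?_
    rw [← Finset.mul_sum, mul_comm]
    exact mul_le_mul_of_nonneg_right (hC i) (sq_nonneg _)
  have hswap : ∑ i ∈ s, ∑ j ∈ s, a j ^ 2 * K i j = ∑ i ∈ s, ∑ j ∈ s, a i ^ 2 * K i j := by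
    rw [Finset.sum_comm]
    simp only [hsymm]
  calc ∑ i ∈ s, ∑ j ∈ s, a i * a j * K i j
      ≤ ∑ i ∈ s, ∑ j ∈ s, (a i ^ 2 * K i j / 2 + a j ^ 2 * K i j / 2) := by
        refine Finset.sum_le_sum fun i _ => Finset.sum_le_sum fun j _ => ?_
        linarith [mul_le_mul_of_nonneg_right (two_mul_le_add_sq (a i) (a j)) (hK i j)]
    _ = ∑ i ∈ s, ∑ j ∈ s, a i ^ 2 * K i j := by
        simp only [Finset.sum_add_distrib, ← Finset.sum_div, hswap, add_halves]
    _ ≤ C * ∑ i ∈ s, a i ^ 2 := hrow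

variable {𝕜 H ι : Type*} [RCLike 𝕜] [NormedAddCommGroup H] [InnerProductSpace 𝕜 H]

lemma norm_sum_smul_sq_le (s : Finset ι) (c : ι → 𝕜) (v : ι → H) :
    ‖∑ i ∈ s, c i • v i‖ ^ 2 ≤ ∑ i ∈ s, ∑ j ∈ s, ‖c i‖ * ‖c j‖ * ‖inner 𝕜 (v i) (v j)‖ := by
  have hnorm : ‖∑ i ∈ s, c i • v i‖ ^ 2 = ‖inner 𝕜 (∑ i ∈ s, c i • v i) (∑ i ∈ s, c i • v i)‖ := by
    rw [inner_self_eq_norm_sq_to_K, norm_pow, RCLike.norm_ofReal, abs_norm]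
  rw [hnorm, sum_inner]
  refine norm_sum_le_of_le _ fun i _ => ?_
  rw [inner_sum]
  refine norm_sum_le_of_le _ fun j _ => ?_
  rw [inner_smul_left, inner_smul_right, norm_mul, norm_mul, RCLike.norm_conj, mul_assoc]

lemma norm_sum_smul_sq_le_of_gram {v : ι → H} {K : ι → ι → ℝ} {C : ℝ}
    (hK : ∀ i j, ‖inner 𝕜 (v i) (v j)‖ ≤ K i j) (hsymm : ∀ i j, K i j = K j i) {s : Finset ι}
    (hC : ∀ i, ∑ j ∈ s, K i j ≤ C) (c : ι → 𝕜) :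
    ‖∑ i ∈ s, c i • v i‖ ^ 2 ≤ C * ∑ i ∈ s, ‖c i‖ ^ 2 := by
  refine (norm_sum_smul_sq_le s c v).trans (le_trans ?_ (sum_mul_mul_le_of_symm
    (fun i j => (norm_nonneg _).trans (hK i j)) hsymm hC fun i => ‖c i‖))
  gcongr
  exact hK _ _

variable {v : ι → H} {C : ℝ}

lemma sum_norm_inner_sq_le (hC : 0 ≤ C) {s : Finset ι}
    (h : ∀ c : ι → 𝕜, ‖∑ i ∈ s, c i • v i‖ ^ 2 ≤ C * ∑ i ∈ s, ‖c i‖ ^ 2) (f : H) :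
    ∑ i ∈ s, ‖inner 𝕜 f (v i)‖ ^ 2 ≤ C * ‖f‖ ^ 2 := by
  set S := ∑ i ∈ s, ‖inner 𝕜 f (v i)‖ ^ 2 with hS
  set g := ∑ i ∈ s, inner 𝕜 (v i) f • v i with hg
  have hS0 : 0 ≤ S := by positivity
  have hfg : inner 𝕜 f g = (S : 𝕜) := by
    rw [hg, inner_sum, hS, RCLike.ofReal_sum]
    refine Finset.sum_congr rfl fun i _ => ?_
    rw [inner_smul_right, ← inner_conj_symm, RCLike.conj_mul, RCLike.ofReal_pow]
  have hgS : ‖g‖ ^ 2 ≤ C * S := by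
    simpa only [hS, norm_inner_symm f] using h fun i => inner 𝕜 (v i) f
  have hSfg : S ≤ ‖f‖ * ‖g‖ := by
    have := norm_inner_le_norm (𝕜 := 𝕜) f g
    rwa [hfg, RCLike.norm_ofReal, abs_of_nonneg hS0] at this
  rcases hS0.eq_or_lt with h0 | h0
  · rw [← h0]
    positivity
  · refine le_of_mul_le_mul_right ?_ h0
    calc S * S ≤ (‖f‖ * ‖g‖) * (‖f‖ * ‖g‖) := by gcongr
      _ = ‖f‖ ^ 2 * ‖g‖ ^ 2 := by ring
      _ ≤ ‖f‖ ^ 2 * (C * S) := by gcongr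
      _ = C * ‖f‖ ^ 2 * S := by ring

lemma bessel_of_norm_sum_smul_sq_le (hC : 0 ≤ C)
    (h : ∀ (s : Finset ι) (c : ι → 𝕜), ‖∑ i ∈ s, c i • v i‖ ^ 2 ≤ C * ∑ i ∈ s, ‖c i‖ ^ 2) (f : H) :
    Summable (fun n => ‖inner 𝕜 f (v n)‖ ^ 2) ∧
      Real.sqrt (∑' n, ‖inner 𝕜 f (v n)‖ ^ 2) ≤ Real.sqrt C * ‖f‖ := by
  have hsum : ∀ s, ∑ i ∈ s, ‖inner 𝕜 f (v i)‖ ^ 2 ≤ C * ‖f‖ ^ 2 := fun s =>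
    sum_norm_inner_sq_le hC (h s) f
  have hs : Summable fun n => ‖inner 𝕜 f (v n)‖ ^ 2 :=
    summable_of_sum_le (fun _ => by positivity) hsum
  refine ⟨hs, ?_⟩
  rw [Real.sqrt_le_left (by positivity), mul_pow, Real.sq_sqrt hC]
  exact hs.tsum_le_of_sum_le hsum

end BesselInequality

section QFSystems

variable {ι H H' : Type*} [NormedAddCommGroup H] [InnerProductSpace ℂ H] [NormedAddCommGroup H']
  [InnerProductSpace ℂ H'] {v : ι → H}

lemma IsQFSystem.map (hv : IsQFSystem v) (U : H ≃ₗᵢ[ℂ] H') : IsQFSystem fun i => U (v i) where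
  approx q hq := by
    obtain ⟨C, hC⟩ := hv.approx q hq
    refine ⟨C, fun f η hη => ?_⟩
    obtain ⟨c, hcf, hcq⟩ := hC (U.symm f) η hη
    refine ⟨c, ?_, by simpa only [LinearIsometryEquiv.norm_map] using hcq⟩
    rw [← U.norm_map, map_sub, map_sum] at hcf
    simpa only [LinearIsometryEquiv.apply_symm_apply, map_smul] using hcf
  bessel := by
    obtain ⟨C, hC⟩ := hv.bessel
    have hinner : ∀ f i, inner ℂ (U.symm f) (v i) = inner ℂ f (U (v i)) := fun f i => by
      rw [← U.inner_map_map, U.apply_symm_apply]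
    exact ⟨C, fun f => by simpa only [hinner, LinearIsometryEquiv.norm_map] using hC (U.symm f)⟩

lemma isQFSystem_of_blocks {κ : Type*} {y : κ → H} {b : ℕ → ι →₀ ℂ} {k : ℕ → κ}
    (hbessel : ∃ C' : ℝ, ∀ f : H, Summable (fun n => ‖inner ℂ f (v n)‖ ^ 2) ∧
      Real.sqrt (∑' n, ‖inner ℂ f (v n)‖ ^ 2) ≤ C' * ‖f‖)
    (hy : (Submodule.span ℂ (Set.range y)).topologicalClosure = ⊤)
    (hk : ∀ r, ∃ᶠ j in atTop, k j = r)
    (hb : Pairwise fun i j => Disjoint (b i).support (b j).support)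
    (hbq : ∀ j : ℕ, powSum (2 + 1 / ((j : ℝ) + 1)) (b j) ≤ (1 / 2) ^ j)
    (hby : Tendsto (fun j => y (k j) - Finsupp.linearCombination ℂ v (b j)) atTop (𝓝 0)) :
    IsQFSystem v := by
  refine ⟨fun q hq => ⟨1, fun f η hη => ?_⟩, hbessel⟩
  have hq0 : 0 < q := by linarith
  rcases eq_or_ne f 0 with rfl | hf
  · exact ⟨0, by simpa using hη, by simp [hq0.ne']⟩
  obtain ⟨c, hcf, hcq⟩ := exists_linearCombination_approx hy hb hk hby hq0.ne'
    (tendsto_powSum hbq hq) f hη (Real.rpow_pos_of_pos (norm_pos_iff.2 hf) q)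
  refine ⟨c, hcf, ?_⟩
  rw [one_mul, one_div]
  exact (Real.rpow_inv_le_iff_of_pos (powSum_nonneg q c) (norm_nonneg f) hq0).2 hcq

end QFSystems

section FourierTransforms

open SchwartzMap

section Injectivity

variable {V : Type*} [NormedAddCommGroup V] [InnerProductSpace ℝ V] [FiniteDimensional ℝ V]
  [MeasurableSpace V] [BorelSpace V]

lemma integral_fourier_schwartz_mul {h : V → ℂ} (hh : Integrable h) (ψ : 𝓢(V, ℂ)) :
    ∫ x, 𝓕 ψ x * h x = ∫ x, ψ x * 𝓕 h x := by
  have hflip := VectorFourier.integral_fourierIntegral_smul_eq_flip (μ := volume) (ν := volume)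
    (L := innerₗ V) Real.continuous_fourierChar continuous_inner (f := ψ) (g := h) ψ.integrable hh
  simp only [flip_innerₗ, smul_eq_mul] at hflip
  exact hflip

lemma ae_eq_of_integral_schwartz_mul_eq {f g : V → ℂ} (hf : LocallyIntegrable f)
    (hg : LocallyIntegrable g) (h : ∀ ψ : 𝓢(V, ℂ), ∫ x, ψ x * f x = ∫ x, ψ x * g x) :
    f =ᵐ[volume] g := by
  refine ae_eq_of_integral_contDiff_smul_eq hf hg fun φ hφ hφc => ?_
  have hc : HasCompactSupport fun x => (φ x : ℂ) := hφc.comp_left (g := ((↑) : ℝ → ℂ)) (by simp)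
  have hs : ContDiff ℝ ∞ fun x => (φ x : ℂ) := Complex.ofRealCLM.contDiff.comp hφ
  simpa using h (hc.toSchwartzMap hs)

lemma continuous_fourier {h : V → ℂ} (hh : Integrable h) : Continuous (𝓕 h) :=
  VectorFourier.fourierIntegral_continuous Real.continuous_fourierChar (innerSL ℝ).continuous₂ hh

lemma ae_eq_zero_of_fourier_eqOn_zero {h : V → ℂ} (hh : Integrable h) {s : Set V} (hs : Dense s)
    (h0 : Set.EqOn (𝓕 h) 0 s) : h =ᵐ[volume] 0 := by
  have hzero : 𝓕 h = 0 := (continuous_fourier hh).ext_on hs continuous_const h0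
  refine ae_eq_of_integral_schwartz_mul_eq hh.locallyIntegrable (locallyIntegrable_const 0)
    fun ψ => ?_
  have hpair := integral_fourier_schwartz_mul hh (𝓕⁻ ψ)
  rw [FourierTransform.fourier_fourierInv_eq, hzero] at hpair
  simpa using hpair

lemma coeFn_fourier_toLp {h : V → ℂ} (h1 : Integrable h) (h2 : MemLp h 2 volume) :
    (𝓕 (h2.toLp h) : Lp ℂ 2 (volume : Measure V)) =ᵐ[volume] 𝓕 h := by
  refine ae_eq_of_integral_schwartz_mul_eq ((Lp.memLp _).locallyIntegrable (by norm_num))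
    (continuous_fourier h1).locallyIntegrable fun ψ => ?_
  have hdist := congrArg (fun d => d ψ) (Lp.fourier_toTemperedDistribution_eq (h2.toLp h))
  simp only [TemperedDistribution.fourier_apply, Lp.toTemperedDistribution_apply,
    smul_eq_mul] at hdist
  rw [← hdist, ← integral_fourier_schwartz_mul h1]
  refine integral_congr_ae ?_
  filter_upwards [h2.coeFn_toLp] with x hx
  rw [hx]

end Injectivity

section Modulation

lemma memLp_fourierChar_mul {p : ENNReal} {w : ℝ → ℂ} (hw : MemLp w p volume)
    (a : ℝ) : MemLp (fun x => 𝐞 (a * x) * w x) p volume :=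
  hw.of_le ((by fun_prop : Continuous fun x => (𝐞 (a * x) : ℂ)).aestronglyMeasurable.mul hw.1)
    (Eventually.of_forall fun x => by rw [norm_mul, Circle.norm_coe, one_mul])

/-- The modulation `x ↦ exp (2 π i a x) w x` of a square integrable function `w`, as an element of
`L²(ℝ)`; the Fourier transform turns it into the translate by `a` of the transform of `w`. -/
noncomputable def modulateLp (w : ℝ → ℂ) (hw : MemLp w 2 volume) (a : ℝ) :
    Lp ℂ 2 (volume : Measure ℝ) :=
  MemLp.toLp (fun x => 𝐞 (a * x) * w x) (memLp_fourierChar_mul hw a)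

variable {w : ℝ → ℂ} (hw : MemLp w 2 volume)

lemma coeFn_modulateLp (a : ℝ) : modulateLp w hw a =ᵐ[volume] fun x => 𝐞 (a * x) * w x :=
  MemLp.coeFn_toLp _

lemma coeFn_sum_smul_modulateLp {ι : Type*} (s : Finset ι) (c : ι → ℂ) (lam : ι → ℝ) :
    (∑ n ∈ s, c n • modulateLp w hw (lam n) : Lp ℂ 2 (volume : Measure ℝ)) =ᵐ[volume]
      fun x => (∑ n ∈ s, c n * 𝐞 (lam n * x)) * w x := by
  filter_upwards [Lp.coeFn_finsetSum s fun n => c n • modulateLp w hw (lam n),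
    s.eventually_all.2 fun n _ => Lp.coeFn_smul (c n) (modulateLp w hw (lam n)),
    s.eventually_all.2 fun n _ => coeFn_modulateLp hw (lam n)] with x hsum hsmul hmod
  rw [hsum, Finset.sum_apply, Finset.sum_mul]
  refine Finset.sum_congr rfl fun n hn => ?_
  rw [hsmul n hn, Pi.smul_apply, hmod n hn, smul_eq_mul, mul_assoc]

lemma inner_modulateLp (a : ℝ) (f : Lp ℂ 2 (volume : Measure ℝ)) :
    inner ℂ (modulateLp w hw a) f = 𝓕 (fun x => starRingEnd ℂ (w x) * f x) a := by
  rw [Real.fourier_real_eq, L2.inner_def]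
  refine integral_congr_ae ?_
  filter_upwards [coeFn_modulateLp hw a] with x hx
  rw [hx, RCLike.inner_apply, map_mul, ← Circle.coe_inv_eq_conj, ← AddChar.map_neg_eq_inv,
    Circle.smul_def, smul_eq_mul, mul_comm a]
  ring

lemma span_modulateLp_topologicalClosure (hw0 : ∀ᵐ x, w x ≠ 0) {s : Set ℝ} (hs : Dense s) :
    (Submodule.span ℂ (modulateLp w hw '' s)).topologicalClosure = ⊤ := by
  rw [Submodule.topologicalClosure_eq_top_iff, Submodule.eq_bot_iff]
  intro f hf
  have hint : Integrable fun x => starRingEnd ℂ (w x) * f x := hw.star.integrable_mul (Lp.memLp f)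
  have hzero := ae_eq_zero_of_fourier_eqOn_zero hint hs fun a ha => by
    rw [← inner_modulateLp hw]
    exact (Submodule.mem_orthogonal _ _).1 hf _ (Submodule.subset_span ⟨a, ha, rfl⟩)
  rw [Lp.eq_zero_iff_ae_eq_zero]
  filter_upwards [hzero, hw0] with x hx hx'
  simpa [hx'] using hx

lemma fourier_fourierChar_mul (w : ℝ → ℂ) (a t : ℝ) :
    𝓕 (fun x => 𝐞 (a * x) * w x) t = 𝓕 w (t - a) := by
  have harg : ∀ x, -(x * (t - a)) = -(x * t) + a * x := fun x => by ring
  simp only [Real.fourier_real_eq, harg, AddChar.map_add_eq_mul, Circle.smul_def, smul_eq_mul,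
    Circle.coe_mul, mul_assoc]

lemma memLp_fourier (hw : MemLp w 2 volume) (hw1 : Integrable w) : MemLp (𝓕 w) 2 volume :=
  (memLp_congr_ae (coeFn_fourier_toLp hw1 hw)).1 (Lp.memLp _)

lemma fourier_modulateLp (hw1 : Integrable w) (a : ℝ) :
    Lp.fourierTransformₗᵢ ℝ ℂ (modulateLp w hw a) = translateLp (𝓕 w) (memLp_fourier hw hw1) a := by
  refine Lp.ext (Filter.EventuallyEq.trans ?_ (MemLp.coeFn_toLp _).symm)
  refine (coeFn_fourier_toLp ?_ (memLp_fourierChar_mul hw a)).trans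
    (Eventually.of_forall (fourier_fourierChar_mul w a))
  exact memLp_one_iff_integrable.1 (memLp_fourierChar_mul (memLp_one_iff_integrable.2 hw1) a)

end Modulation

lemma exists_entire_fourier {w : ℝ → ℝ} (hw : Measurable w) (hw0 : ∀ x, 0 ≤ w x)
    (hexp : ∀ s : ℝ, Integrable fun x => Real.exp (s * x) * w x) :
    ∃ G : ℂ → ℂ, Differentiable ℂ G ∧ ∀ t : ℝ, 𝓕 (fun x => (w x : ℂ)) t = G t := by
  set μ : Measure ℝ := volume.withDensity fun x => ENNReal.ofReal (w x)
  have hset : ProbabilityTheory.integrableExpSet id μ = Set.univ := by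
    refine Set.eq_univ_of_forall fun s => ?_
    change Integrable (fun x => Real.exp (s * id x)) μ
    rw [integrable_withDensity_iff_integrable_smul' hw.ennreal_ofReal (by simp)]
    simpa only [ENNReal.toReal_ofReal (hw0 _), smul_eq_mul, mul_comm (w _), id] using hexp s
  have hdiff : Differentiable ℂ (ProbabilityTheory.complexMGF id μ) := by
    simpa [hset, differentiableOn_univ] using
      ProbabilityTheory.differentiableOn_complexMGF (X := id) (μ := μ)
  refine ⟨fun z => ProbabilityTheory.complexMGF id μ (-(2 * Real.pi * Complex.I) * z),
    hdiff.comp (by fun_prop), fun t => ?_⟩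
  beta_reduce
  rw [Real.fourier_real_eq, ProbabilityTheory.complexMGF.eq_def,
    integral_withDensity_eq_integral_toReal_smul hw.ennreal_ofReal (by simp)]
  refine integral_congr_ae (Eventually.of_forall fun x => ?_)
  simp only [ENNReal.toReal_ofReal (hw0 x), Complex.real_smul, id, Circle.smul_def, smul_eq_mul,
    Real.fourierChar_apply]
  rw [mul_comm]
  congr 2
  push_cast
  ring

end FourierTransforms

section Weights

lemma ae_bddAbove_of_integral_min_one_le {Δ : ℕ → ℝ → ℝ} (hΔm : ∀ j, Measurable (Δ j))
    (hΔ0 : ∀ j x, 0 ≤ Δ j x)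
    (hΔ : ∀ j : ℕ, ∫ x in (-j : ℝ)..j, min 1 (Δ j x) ≤ (1 / 2) ^ j) :
    ∀ᵐ x, BddAbove (Set.range fun j => Δ j x) := by
  have hmeas : ∀ j : ℕ, volume ({x | 1 ≤ Δ j x} ∩ Set.Ioc (-j : ℝ) j) ≤
      ENNReal.ofReal ((1 / 2) ^ j) := fun j => by
    have hj : (-j : ℝ) ≤ j := neg_le_self j.cast_nonneg
    have hint : IntegrableOn (fun x => min 1 (Δ j x)) (Set.Ioc (-j : ℝ) j) :=
      Measure.integrableOn_of_bounded (M := 1) measure_Ioc_lt_top.ne (by fun_prop) <|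
        Eventually.of_forall fun x => by
          simp [abs_of_nonneg (le_min zero_le_one (hΔ0 j x))]
    have hmarkov := mul_meas_ge_le_integral_of_nonneg
      (Eventually.of_forall fun x => le_min zero_le_one (hΔ0 j x)) hint 1
    rw [one_mul, ← intervalIntegral.integral_of_le hj] at hmarkov
    have hset : {x | 1 ≤ min 1 (Δ j x)} = {x | 1 ≤ Δ j x} := by simp
    rw [hset, measureReal_restrict_apply (measurableSet_le measurable_const (hΔm j))] at hmarkov
    refine (ENNReal.le_ofReal_iff_toReal_le ?_ (by positivity)).2 (hmarkov.trans (hΔ j))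
    exact measure_ne_top_of_subset Set.inter_subset_right measure_Ioc_lt_top.ne
  have hsum : ∑' j : ℕ, volume ({x | 1 ≤ Δ j x} ∩ Set.Ioc (-j : ℝ) j) ≠ ⊤ :=
    ne_top_of_le_ne_top summable_geometric_two.tsum_ofReal_ne_top (ENNReal.tsum_le_tsum hmeas)
  filter_upwards [ae_eventually_notMem hsum] with x hx
  refine IsBoundedUnder.bddAbove_range ⟨1, ?_⟩
  rw [eventually_map]
  filter_upwards [hx, tendsto_natCast_atTop_atTop.eventually_gt_atTop |x|] with j hj hxj
  exact (not_le.1 fun h => hj ⟨h, (abs_lt.1 hxj).1, (abs_lt.1 hxj).2.le⟩).le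

lemma exists_measurable_mul_le {α ι : Type*} [MeasurableSpace α] [Countable ι] {μ : Measure α}
    {Δ : ι → α → ℝ} (hΔm : ∀ j, Measurable (Δ j))
    (hΔ : ∀ᵐ x ∂μ, BddAbove (Set.range fun j => Δ j x)) {γ : α → ℝ} (hγm : Measurable γ)
    (hγ : ∀ x, 0 < γ x) :
    ∃ w : α → ℝ, Measurable w ∧ (∀ x, 0 ≤ w x) ∧ (∀ x, w x ≤ γ x) ∧ (∀ᵐ x ∂μ, w x ≠ 0) ∧
      ∀ j x, w x * Δ j x ≤ γ x := by
  set S : α → ENNReal := fun x => ⨆ j, ENNReal.ofReal (Δ j x)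
  have hSm : Measurable S := Measurable.iSup fun j => (hΔm j).ennreal_ofReal
  have hw0 : ∀ x, 0 ≤ ((1 + S x)⁻¹).toReal := fun x => ENNReal.toReal_nonneg
  have hw1 : ∀ x, ((1 + S x)⁻¹).toReal ≤ 1 := fun x =>
    ENNReal.toReal_le_of_le_ofReal zero_le_one (by simp)
  have hwΔ : ∀ j x, ((1 + S x)⁻¹).toReal * Δ j x ≤ 1 := fun j x => by
    rcases le_or_gt (Δ j x) 0 with h0 | h0
    · exact (mul_nonpos_of_nonneg_of_nonpos (hw0 x) h0).trans zero_le_one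
    rw [← ENNReal.toReal_ofReal h0.le, ← ENNReal.toReal_mul]
    refine ENNReal.toReal_le_of_le_ofReal zero_le_one ?_
    rw [ENNReal.ofReal_one]
    refine le_trans ?_ (ENNReal.inv_mul_le_one (1 + S x))
    gcongr
    exact (le_iSup (fun j => ENNReal.ofReal (Δ j x)) j).trans le_add_self
  have hw_ne : ∀ᵐ x ∂μ, ((1 + S x)⁻¹).toReal ≠ 0 := by
    filter_upwards [hΔ] with x ⟨B, hB⟩
    have hSx : S x ≤ ENNReal.ofReal B := iSup_le fun j => ENNReal.ofReal_le_ofReal (hB ⟨j, rfl⟩)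
    have hne : 1 + S x ≠ ⊤ :=
      ENNReal.add_ne_top.2 ⟨ENNReal.one_ne_top, ne_top_of_le_ne_top ENNReal.ofReal_ne_top hSx⟩
    exact ENNReal.toReal_ne_zero.2 ⟨ENNReal.inv_ne_zero.2 hne, by simp⟩
  refine ⟨fun x => γ x * ((1 + S x)⁻¹).toReal,
    hγm.mul ((measurable_const.add hSm).inv.ennreal_toReal), fun x => mul_nonneg (hγ x).le (hw0 x),
    fun x => mul_le_of_le_one_right (hγ x).le (hw1 x), ?_, fun j x => ?_⟩
  · filter_upwards [hw_ne] with x hx using mul_ne_zero (hγ x).ne' hx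
  · rw [mul_assoc]
    exact mul_le_of_le_one_right (hγ x).le (hwΔ j x)

end Weights

section GaussianWeights

/-- The square root of the density `exp (-π x²)`. As a weight it makes the Gram matrix of the
modulations explicit, and the weights it dominates have entire Fourier transforms. -/
noncomputable def sqrtGaussian (x : ℝ) : ℝ := Real.exp (-(Real.pi / 2) * x ^ 2)

lemma sqrtGaussian_pos (x : ℝ) : 0 < sqrtGaussian x := Real.exp_pos _

@[fun_prop]
lemma continuous_sqrtGaussian : Continuous sqrtGaussian := by
  unfold sqrtGaussian
  fun_prop

lemma sqrtGaussian_sq (x : ℝ) : sqrtGaussian x ^ 2 = Real.exp (-Real.pi * x ^ 2) := by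
  rw [sqrtGaussian, ← Real.exp_nat_mul]
  congr 1
  push_cast
  ring

lemma memLp_sqrtGaussian : MemLp (fun x => (sqrtGaussian x : ℂ)) 2 volume := by
  have hreal : MemLp sqrtGaussian 2 volume := by
    refine (memLp_two_iff_integrable_sq (by fun_prop)).2 ?_
    simpa only [sqrtGaussian_sq] using integrable_exp_neg_mul_sq Real.pi_pos
  exact hreal.ofReal

lemma inner_modulateLp_sqrtGaussian (a b : ℝ) :
    inner ℂ (modulateLp _ memLp_sqrtGaussian a) (modulateLp _ memLp_sqrtGaussian b) =
      (Real.exp (-Real.pi * (a - b) ^ 2) : ℂ) := by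
  have hgauss := congrFun (fourier_gaussian_pi (b := 1) (by simp)) (a - b)
  have hprod : (fun x => starRingEnd ℂ (sqrtGaussian x : ℂ) *
      modulateLp _ memLp_sqrtGaussian b x) =ᵐ[volume]
      fun x => 𝐞 (b * x) * Complex.exp (-Real.pi * 1 * x ^ 2) := by
    filter_upwards [coeFn_modulateLp memLp_sqrtGaussian b] with x hx
    have hsq : (sqrtGaussian x : ℂ) * sqrtGaussian x = Complex.exp (-Real.pi * 1 * x ^ 2) := by
      rw [← sq, ← Complex.ofReal_pow, sqrtGaussian_sq]
      push_cast
      rw [mul_one]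
    rw [hx, Complex.conj_ofReal, ← hsq]
    ring
  rw [inner_modulateLp, Real.fourier_congr_ae hprod, fourier_fourierChar_mul, hgauss]
  push_cast
  simp

lemma summable_exp_neg_pi_int_sq : Summable fun k : ℤ => Real.exp (-Real.pi * (k : ℝ) ^ 2) := by
  have hnat : Summable fun k : ℕ => Real.exp (-Real.pi * (k : ℝ) ^ 2) := by
    refine Real.summable_exp_neg_nat.of_nonneg_of_le (fun _ => (Real.exp_pos _).le) fun k => ?_
    have hk : (k : ℝ) ≤ (k : ℝ) ^ 2 := by exact_mod_cast Nat.le_self_pow two_ne_zero k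
    exact Real.exp_le_exp.2 (by nlinarith [Real.pi_gt_three, sq_nonneg (k : ℝ)])
  exact Summable.of_nat_of_neg (by simpa using hnat) (by simpa using hnat)

lemma sum_exp_neg_pi_sq_le {lam : ℕ → ℝ} (h : ∀ n, lam n + 1 ≤ lam (n + 1)) (s : Finset ℕ)
    (i : ℕ) : ∑ j ∈ s, Real.exp (-Real.pi * (lam i - lam j) ^ 2) ≤
      ∑' k : ℤ, Real.exp (-Real.pi * (k : ℝ) ^ 2) := by
  calc ∑ j ∈ s, Real.exp (-Real.pi * (lam i - lam j) ^ 2)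
      ≤ ∑ j ∈ s, Real.exp (-Real.pi * (((i : ℤ) - j : ℤ) : ℝ) ^ 2) := by
        refine Finset.sum_le_sum fun j _ => Real.exp_le_exp.2 ?_
        have hsep := sq_le_sq.2 (abs_natCast_sub_le_of_add_one_le h i j)
        push_cast
        nlinarith [Real.pi_pos]
    _ = ∑ k ∈ s.image fun j : ℕ => ((i : ℤ) - j : ℤ), Real.exp (-Real.pi * (k : ℝ) ^ 2) := by
        rw [Finset.sum_image fun a _ b _ hab => by simpa using hab]
    _ ≤ ∑' k : ℤ, Real.exp (-Real.pi * (k : ℝ) ^ 2) :=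
        summable_exp_neg_pi_int_sq.sum_le_tsum _ fun _ _ => (Real.exp_pos _).le

lemma norm_sum_smul_modulateLp_le {w γ : ℝ → ℂ} (hw : MemLp w 2 volume) (hγ : MemLp γ 2 volume)
    (hwγ : ∀ x, ‖w x‖ ≤ ‖γ x‖) {ι : Type*} (s : Finset ι) (c : ι → ℂ) (lam : ι → ℝ) :
    ‖∑ n ∈ s, c n • modulateLp w hw (lam n)‖ ≤ ‖∑ n ∈ s, c n • modulateLp γ hγ (lam n)‖ := by
  refine Lp.norm_le_norm_of_ae_le ?_
  filter_upwards [coeFn_sum_smul_modulateLp hw s c lam, coeFn_sum_smul_modulateLp hγ s c lam]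
    with x hx hx'
  rw [hx, hx', norm_mul, norm_mul]
  gcongr
  exact hwγ x

lemma bessel_modulateLp {w : ℝ → ℂ} (hw : MemLp w 2 volume) (hwG : ∀ x, ‖w x‖ ≤ sqrtGaussian x)
    {lam : ℕ → ℝ} (h : ∀ n, lam n + 1 ≤ lam (n + 1)) :
    ∃ C' : ℝ, ∀ f : Lp ℂ 2 (volume : Measure ℝ),
      Summable (fun n => ‖inner ℂ f (modulateLp w hw (lam n))‖ ^ 2) ∧
      Real.sqrt (∑' n, ‖inner ℂ f (modulateLp w hw (lam n))‖ ^ 2) ≤ C' * ‖f‖ := by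
  refine ⟨_, bessel_of_norm_sum_smul_sq_le (C := ∑' k : ℤ, Real.exp (-Real.pi * (k : ℝ) ^ 2))
    (tsum_nonneg fun _ => (Real.exp_pos _).le) fun s c => ?_⟩
  have hdom := norm_sum_smul_modulateLp_le hw memLp_sqrtGaussian (fun x => by
    rw [Complex.norm_of_nonneg (sqrtGaussian_pos x).le]
    exact hwG x) s c lam
  refine (pow_le_pow_left₀ (norm_nonneg _) hdom 2).trans (norm_sum_smul_sq_le_of_gram
    (K := fun i j => Real.exp (-Real.pi * (lam i - lam j) ^ 2)) (fun i j => ?_) (fun i j => ?_)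
    (sum_exp_neg_pi_sq_le h s) c)
  · rw [inner_modulateLp_sqrtGaussian, Complex.norm_of_nonneg (Real.exp_pos _).le]
  · rw [← neg_sub, neg_sq]

lemma integrable_exp_mul_of_le_sqrtGaussian {w : ℝ → ℝ} (hw : Measurable w)
    (hw0 : ∀ x, 0 ≤ w x) (hwG : ∀ x, w x ≤ sqrtGaussian x) (s : ℝ) :
    Integrable fun x => Real.exp (s * x) * w x := by
  refine Integrable.mono' (g := fun x => Real.exp (s ^ 2 / Real.pi) *
    Real.exp (-(Real.pi / 4) * x ^ 2)) ((integrable_exp_neg_mul_sq (by positivity)).const_mul _)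
    (by fun_prop) (Eventually.of_forall fun x => ?_)
  rw [Real.norm_of_nonneg (mul_nonneg (Real.exp_pos _).le (hw0 x))]
  have hsq : 0 ≤ (s - Real.pi / 2 * x) ^ 2 / Real.pi := by positivity
  have hexpand : (s - Real.pi / 2 * x) ^ 2 / Real.pi =
      s ^ 2 / Real.pi - s * x + Real.pi / 4 * x ^ 2 := by
    field_simp
    ring
  calc Real.exp (s * x) * w x ≤ Real.exp (s * x) * sqrtGaussian x := by
        gcongr
        exact hwG x
    _ ≤ Real.exp (s ^ 2 / Real.pi) * Real.exp (-(Real.pi / 4) * x ^ 2) := by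
        rw [sqrtGaussian, ← Real.exp_add, ← Real.exp_add]
        exact Real.exp_le_exp.2 (by linarith)

end GaussianWeights

section Construction

lemma sum_embDomain_fourierChar {ι κ : Type*} (e : ι ↪ κ) (c : ι →₀ ℂ) {lam : κ → ℝ} {μ : ι → ℝ}
    {a r : ℝ} (h : ∀ i ∈ c.support, lam (e i) = a + r * μ i) (x : ℝ) :
    ((c.embDomain e).sum fun n z => z * 𝐞 (lam n * x)) =
      𝐞 (a * x) * c.sum fun i z => z * 𝐞 (μ i * (r * x)) := by
  rw [Finsupp.sum_embDomain, Finsupp.mul_sum]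
  refine Finset.sum_congr rfl fun i hi => ?_
  beta_reduce
  have harg : lam (e i) * x = a * x + μ i * (r * x) := by
    rw [h i hi]
    ring
  rw [harg, AddChar.map_add_eq_mul, Circle.coe_mul]
  ring

lemma integral_min_one_mul_comp_le {f : ℝ → ℝ} (hf : Continuous f) (hper : Function.Periodic f 1)
    {A δ : ℝ} (hA : 1 ≤ A) (hδ : ∫ x in (0 : ℝ)..1, min 1 (f x) ≤ δ) {R : ℕ} (hR : R ≠ 0)
    {a b : ℤ} (hab : a ≤ b) : ∫ x in (a : ℝ)..b, min 1 (A * f (R * x)) ≤ A * ((b - a) * δ) := by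
  have hcomp := integral_comp_intCast_mul_of_periodic (f := fun x => min 1 (f x)) (by fun_prop)
    (fun x => by simp only [hper x]) (Int.natCast_ne_zero.2 hR) a b
  rw [Int.cast_natCast] at hcomp
  have hab' : (a : ℝ) ≤ b := Int.cast_le.2 hab
  calc ∫ x in (a : ℝ)..b, min 1 (A * f (R * x))
      ≤ ∫ x in (a : ℝ)..b, A * min 1 (f (R * x)) := by
        refine intervalIntegral.integral_mono_on hab'
          (Continuous.intervalIntegrable (by fun_prop) _ _)
          (Continuous.intervalIntegrable (by fun_prop) _ _) fun x _ => ?_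
        rw [mul_min_of_nonneg _ _ (zero_le_one.trans hA), mul_one]
        exact min_le_min_right _ hA
    _ = A * ((b - a) * ∫ x in (0 : ℝ)..1, min 1 (f x)) := by
        rw [intervalIntegral.integral_const_mul, hcomp]
    _ ≤ A * ((b - a) * δ) := by
        have := sub_nonneg.2 hab'
        gcongr

lemma integral_min_one_mul_norm_one_sub_sum_le {c : ℕ →₀ ℂ} {A δ : ℝ} (hA : 1 ≤ A)
    (hδ : ∫ x in (0 : ℝ)..1, min 1 ‖1 - c.sum fun n z => z * 𝐞 (n * x)‖ ≤ δ) {R : ℕ} (hR : R ≠ 0)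
    {a b : ℤ} (hab : a ≤ b) :
    ∫ x in (a : ℝ)..b, min 1 (A * ‖1 - c.sum fun n z => z * 𝐞 (n * (R * x))‖) ≤
      A * ((b - a) * δ) := by
  have hper : ∀ (n : ℕ) (x : ℝ), 𝐞 (n * (x + 1)) = 𝐞 (n * x) := fun n x => by
    rw [← Int.cast_natCast, fourierChar_intCast_mul, fourierChar_add_one, fourierChar_intCast_mul]
  refine integral_min_one_mul_comp_le (f := fun x => ‖1 - c.sum fun n z => z * 𝐞 (n * x)‖) ?_
    (fun x => by simp only [hper]) hA hδ hR hab
  unfold Finsupp.sum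
  fun_prop

lemma mem_Ioc_of_mem_support {c : ℕ →₀ ℂ} (hc0 : c 0 = 0) {i : ℕ} (hi : i ∈ c.support) :
    i ∈ Set.Ioc 0 (c.support.sup id) :=
  ⟨Nat.pos_of_ne_zero fun h => Finsupp.mem_support_iff.1 hi (h ▸ hc0),
    Finset.le_sup (f := id) hi⟩

lemma mem_Ioc_of_mem_support_embDomain {c : ℕ →₀ ℂ} (hc0 : c 0 = 0) {N n : ℕ}
    (hn : n ∈ (c.embDomain (addLeftEmbedding N)).support) :
    n ∈ Set.Ioc N (N + c.support.sup id) := by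
  rw [Finsupp.support_embDomain, Finset.mem_map] at hn
  obtain ⟨i, hi, rfl⟩ := hn
  obtain ⟨h0, hle⟩ := mem_Ioc_of_mem_support hc0 hi
  exact ⟨Nat.lt_add_of_pos_right h0, Nat.add_le_add_left hle _⟩

lemma exists_quasiLacunary_approx {ε : ℕ → ℝ} (hε0 : ∀ n, 0 ≤ ε n) (hε : Tendsto ε atTop (𝓝 0))
    (k : ℕ → ℝ) :
    ∃ (lam : ℕ → ℝ) (b : ℕ → ℕ →₀ ℂ), (∀ n, 0 < lam n) ∧
      (∀ n, (1 + ε n) * lam n + 1 ≤ lam (n + 1)) ∧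
      (Pairwise fun i j => Disjoint (b i).support (b j).support) ∧
      (∀ j : ℕ, powSum (2 + 1 / ((j : ℝ) + 1)) (b j) ≤ (1 / 2) ^ j) ∧
      ∀ j : ℕ, ∫ x in (-j : ℝ)..j, min 1 (((j : ℝ) + 1) *
        ‖𝐞 (k j * x) - (b j).sum fun n z => z * 𝐞 (lam n * x)‖) ≤ (1 / 2) ^ j := by
  choose c hc0 hcq hc using fun j : ℕ => exists_finsupp_approx_one (q := 2 + 1 / ((j : ℝ) + 1))
    (lt_add_of_pos_right _ (by positivity)) (δ := (1 / 2) ^ j / (2 * (j + 1) ^ 2)) (by positivity)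
  obtain ⟨lam, N, R, hpos, hstep, hN, hlam⟩ := exists_quasiLacunary_blocks hε0 hε
    (fun j => (c j).support.sup id) k
  refine ⟨lam, fun j => (c j).embDomain (addLeftEmbedding (N j)), hpos, hstep, fun i j hij => ?_,
    fun j => ?_, fun j => ?_⟩
  · exact Finset.disjoint_left.2 fun n hi hj => hij (eq_of_mem_Ioc_block hN
      (mem_Ioc_of_mem_support_embDomain (hc0 i) hi) (mem_Ioc_of_mem_support_embDomain (hc0 j) hj))
  · rw [powSum_embDomain]
    exact (hcq j).trans (div_le_self (by positivity) (by nlinarith [j.cast_nonneg (α := ℝ)]))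
  · have hnorm : ∀ x, ‖𝐞 (k j * x) -
        ((c j).embDomain (addLeftEmbedding (N j))).sum fun n z => z * 𝐞 (lam n * x)‖ =
        ‖1 - (c j).sum fun n z => z * 𝐞 (n * (R j * x))‖ := fun x => by
      have hprog : ∀ i ∈ (c j).support, lam (addLeftEmbedding (N j) i) = k j + R j * i :=
        fun i hi => (hlam j).2 i (mem_Ioc_of_mem_support (hc0 j) hi)
      rw [sum_embDomain_fourierChar _ _ hprog, ← mul_one_sub, norm_mul, Circle.norm_coe, one_mul]
    simp only [hnorm]
    have hint := integral_min_one_mul_norm_one_sub_sum_le (A := (j : ℝ) + 1) (a := -j) (b := j)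
      (le_add_of_nonneg_left j.cast_nonneg) (hc j) (hlam j).1 (neg_le_self j.cast_nonneg)
    push_cast at hint
    calc _ ≤ ((j : ℝ) + 1) * ((j - -j) * ((1 / 2) ^ j / (2 * (j + 1) ^ 2))) := hint
      _ = (1 / 2) ^ j * (j / (j + 1)) := by
        field_simp
        ring
      _ ≤ (1 / 2) ^ j := by
        refine mul_le_of_le_one_right (by positivity) ?_
        rw [div_le_one (by positivity)]
        exact (lt_add_one _).le

lemma norm_modulateLp_sub_linearCombination_le {w γ : ℝ → ℂ} (hw : MemLp w 2 volume)
    (hγ : MemLp γ 2 volume) {ι : Type*} (lam : ι → ℝ) (c : ι →₀ ℂ) {a C : ℝ}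
    (h : ∀ x, ‖w x‖ * ‖𝐞 (a * x) - c.sum fun n z => z * 𝐞 (lam n * x)‖ ≤ C * ‖γ x‖) :
    ‖modulateLp w hw a - Finsupp.linearCombination ℂ (fun n => modulateLp w hw (lam n)) c‖ ≤
      C * ‖hγ.toLp γ‖ := by
  refine Lp.norm_le_mul_norm_of_ae_le_mul ?_
  rw [Finsupp.linearCombination_apply, Finsupp.sum]
  filter_upwards [Lp.coeFn_sub (modulateLp w hw a) (∑ n ∈ c.support, c n • modulateLp w hw (lam n)),
    coeFn_modulateLp hw a, coeFn_sum_smul_modulateLp hw c.support c lam, hγ.coeFn_toLp]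
    with x hsub ha hsum hγx
  rw [hsub, Pi.sub_apply, ha, hsum, hγx, ← sub_mul, norm_mul, mul_comm]
  exact h x

lemma isQFSystem_modulateLp {w : ℝ → ℂ} (hw : MemLp w 2 volume)
    (hwG : ∀ x, ‖w x‖ ≤ sqrtGaussian x) (hw0 : ∀ᵐ x, w x ≠ 0) {lam : ℕ → ℝ}
    (hlam : ∀ n, lam n + 1 ≤ lam (n + 1)) {k : ℕ → ℚ} (hk : ∀ r, ∃ᶠ j in atTop, k j = r)
    {b : ℕ → ℕ →₀ ℂ} (hb : Pairwise fun i j => Disjoint (b i).support (b j).support)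
    (hbq : ∀ j : ℕ, powSum (2 + 1 / ((j : ℝ) + 1)) (b j) ≤ (1 / 2) ^ j)
    (hwb : ∀ (j : ℕ) (x : ℝ), ‖w x‖ * (((j : ℝ) + 1) *
      ‖𝐞 (k j * x) - (b j).sum fun n z => z * 𝐞 (lam n * x)‖) ≤ sqrtGaussian x) :
    IsQFSystem fun n => modulateLp w hw (lam n) := by
  refine isQFSystem_of_blocks (y := fun r : ℚ => modulateLp w hw r) (bessel_modulateLp hw hwG hlam)
    ?_ hk hb hbq ?_
  · have hspan := span_modulateLp_topologicalClosure hw hw0 Rat.denseRange_cast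
    rwa [← Set.range_comp] at hspan
  · have hlim := (tendsto_one_div_add_atTop_nhds_zero_nat (𝕜 := ℝ)).mul_const
      ‖memLp_sqrtGaussian.toLp _‖
    rw [zero_mul] at hlim
    refine squeeze_zero_norm (fun j => norm_modulateLp_sub_linearCombination_le hw
      memLp_sqrtGaussian lam (b j) fun x => ?_) hlim
    rw [Complex.norm_of_nonneg (sqrtGaussian_pos x).le, one_div_mul_eq_div,
      le_div_iff₀ (by positivity)]
    linarith [hwb j x]

lemma exists_modulateLp_qfSystem {ε : ℕ → ℝ} (hε0 : ∀ n, 0 ≤ ε n) (hε : Tendsto ε atTop (𝓝 0)) :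
    ∃ (lam : ℕ → ℝ) (w : ℝ → ℝ) (hw : MemLp (fun x => (w x : ℂ)) 2 volume),
      (∀ n, 0 < lam n) ∧ (∀ n, (1 + ε n) * lam n + 1 ≤ lam (n + 1)) ∧ Measurable w ∧
      (∀ x, 0 ≤ w x) ∧ (∀ x, w x ≤ sqrtGaussian x) ∧
      IsQFSystem fun n => modulateLp (fun x => (w x : ℂ)) hw (lam n) := by
  obtain ⟨k, hk⟩ := exists_seq_frequently_eq ℚ
  obtain ⟨lam, b, hpos, hstep, hb, hbq, hbint⟩ :=
    exists_quasiLacunary_approx hε0 hε fun j => (k j : ℝ)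
  have hΔc : ∀ j : ℕ, Continuous fun x : ℝ => ((j : ℝ) + 1) *
      ‖𝐞 (k j * x) - (b j).sum fun n z => z * 𝐞 (lam n * x)‖ := fun j => by
    unfold Finsupp.sum
    fun_prop
  obtain ⟨w, hwm, hw0, hwG, hwne, hwΔ⟩ := exists_measurable_mul_le (fun j => (hΔc j).measurable)
    (ae_bddAbove_of_integral_min_one_le (fun j => (hΔc j).measurable)
      (fun j x => by positivity) hbint) continuous_sqrtGaussian.measurable sqrtGaussian_pos
  have hnorm : ∀ x, ‖(w x : ℂ)‖ = w x := fun x => Complex.norm_of_nonneg (hw0 x)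
  have hw : MemLp (fun x => (w x : ℂ)) 2 volume :=
    memLp_sqrtGaussian.of_le (by fun_prop) <| Eventually.of_forall fun x => by
      rw [hnorm, Complex.norm_of_nonneg (sqrtGaussian_pos x).le]
      exact hwG x
  refine ⟨lam, w, hw, hpos, hstep, hwm, hw0, hwG, isQFSystem_modulateLp hw (fun x => ?_) ?_
    (fun n => ?_) hk hb hbq fun j x => ?_⟩
  · rw [hnorm]
    exact hwG x
  · simpa only [ne_eq, Complex.ofReal_eq_zero] using hwne
  · linarith [hstep n, mul_nonneg (hε0 n) (hpos n).le]
  · rw [hnorm]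
    exact hwΔ j x

lemma exists_quasiLacunary_qfSystem {ε : ℕ → ℝ} (hε0 : ∀ n, 0 ≤ ε n)
    (hε : Tendsto ε atTop (𝓝 0)) :
    ∃ (lam : ℕ → ℝ) (g : ℝ → ℂ) (hg : MemLp g 2 volume),
      UniformlyDiscrete lam ∧
      (∀ n, 0 < lam n) ∧
      (∀ n, lam (n + 1) / lam n > 1 + ε n) ∧
      IsQFSystem (fun n => translateLp g hg (lam n)) ∧
      ∃ G : ℂ → ℂ, Differentiable ℂ G ∧ ∀ t : ℝ, g t = G (t : ℂ) := by
  obtain ⟨lam, w, hw, hpos, hstep, hwm, hw0, hwG, hqf⟩ := exists_modulateLp_qfSystem hε0 hε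
  have hexp := integrable_exp_mul_of_le_sqrtGaussian hwm hw0 hwG
  have hw1 : Integrable fun x => (w x : ℂ) := by simpa using (hexp 0).ofReal (𝕜 := ℂ)
  refine ⟨lam, 𝓕 fun x => (w x : ℂ), memLp_fourier hw hw1, .of_add_one_le fun n => ?_, hpos,
    fun n => ?_, ?_, exists_entire_fourier hwm hw0 hexp⟩
  · linarith [hstep n, mul_nonneg (hε0 n) (hpos n).le]
  · rw [gt_iff_lt, lt_div_iff₀ (hpos n)]
    linarith [hstep n]
  · simpa only [fourier_modulateLp hw hw1] using hqf.map (Lp.fourierTransformₗᵢ ℝ ℂ)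

lemma contDiff_of_eq_entire {g : ℝ → ℂ} {G : ℂ → ℂ} (hG : Differentiable ℂ G)
    (hg : ∀ t : ℝ, g t = G t) : ContDiff ℝ ∞ g := by
  rw [funext hg]
  exact (hG.contDiff.restrict_scalars ℝ).comp Complex.ofRealCLM.contDiff

end Construction

theorem proposition1 :
    (∃ (lam : ℕ → ℝ) (g : ℝ → ℂ) (hg : MemLp g 2 volume),
      UniformlyDiscrete lam ∧
      IsQFSystem (fun n => translateLp g hg (lam n)) ∧
      ContDiff ℝ ∞ g ∧
      ∃ G : ℂ → ℂ, Differentiable ℂ G ∧ ∀ t : ℝ, g t = G (t : ℂ)) ∧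
    (∀ ε : ℕ → ℝ, (∀ n, 0 < ε n) → Tendsto ε atTop (𝓝 0) →
      ∃ (lam : ℕ → ℝ) (g : ℝ → ℂ) (hg : MemLp g 2 volume),
        UniformlyDiscrete lam ∧
        (∀ n, 0 < lam n) ∧
        (∀ n, lam (n + 1) / lam n > 1 + ε n) ∧
        IsQFSystem (fun n => translateLp g hg (lam n)) ∧
        ContDiff ℝ ∞ g ∧
        ∃ G : ℂ → ℂ, Differentiable ℂ G ∧ ∀ t : ℝ, g t = G (t : ℂ)) := by
  refine ⟨?_, fun ε hε0 hε => ?_⟩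
  · obtain ⟨lam, g, hg, hdisc, -, -, hqf, G, hG, hgG⟩ :=
      exists_quasiLacunary_qfSystem (ε := 0) (fun _ => le_rfl) tendsto_const_nhds
    exact ⟨lam, g, hg, hdisc, hqf, contDiff_of_eq_entire hG hgG, G, hG, hgG⟩
  · obtain ⟨lam, g, hg, hdisc, hpos, hratio, hqf, G, hG, hgG⟩ :=
      exists_quasiLacunary_qfSystem (fun n => (hε0 n).le) hε
    exact ⟨lam, g, hg, hdisc, hpos, hratio, hqf, contDiff_of_eq_entire hG hgG, G, hG, hgG⟩
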